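/- Let $A\in\mathbb Q^{m\times n}$, $E\in\mathbb Q^{p\times n}$, $c\in\mathbb Q^{n}$, $n=n_1+n_2$, let $Q\in\mathbb Q^{n\times n}$ be symmetric positive semidefinite and $M\in\mathbb R$. For $b\in\mathbb Q^m$, $f\in\mathbb Q^p$ consider the mixed-integer quadratic program $$z_{IP}=\min\{q(x): Ax=b,\ x\in X\},\qquad q(x)=\tfrac12x^\top Qx-c^\top x,$$ $$X=\{x=(x_I,x_C)\in\mathbb Z^{n_1}\times\mathbb R^{n_2}: Ex\le f,\ \|x_I\|_\infty\le M\}.$$ Let $X_R$ be the continuous relaxation of $X$ (integrality dropped) and $z_R=\inf\{q(x):Ax=b,\ x\in X_R\}$. Let $\varphi(u)=\inf\{q(x):x\in X,\ Ax=b+u\}$ be the value function, and let $U$ be the set of $u\in\mathbb R^m$ for which the program defining $\varphi(u)$ is feasible. For $\psi:\mathbb R^m\to\mathbb R$ and $\rho>0$ put $$z^{LD+}_\rho(\psi)=\sup_{\lambda\in\mathbb R^m}\ \inf_{x\in X}\ \bigl(q(x)+\lambda^\top(b-Ax)+\rho\,\psi(b-Ax)\bigr),$$ and say that $\psi$ has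 an exact penalty representation if $z^{LD+}_\rho(\psi)=z_{IP}$ for some finite $\rho>0$. Let $\|\cdot\|$ be the Euclidean norm and $z_{SALR}(\rho)=\inf_{x\in X}(q(x)+\rho\|b-Ax\|)$. Call $\lambda\in\mathbb R^m$ a multiplier if $q(x)+\lambda^\top(b-Ax)\ge z_R$ for all $x\in X_R$. Then there are constants $K_1,K_2',K_2''\ge0$, depending only on $A,E,Q,c,M$, such that for all $b\in\mathbb Q^m$, $f\in\mathbb Q^p$ for which the program is feasible and $z_R$ is finite, the following holds with $K_2=K_2'+K_2''(\|b\|+\|f\|)$: 1. $\varphi(u)$ is finite and attained for every $u\in U$; in particular $z_{IP}=\varphi(0)$ is finite and attained. 2. The Euclidean norm, and every other norm on $\mathbb R^m$, has an exact penalty representation. 3. A multiplier exists, and there is $\delta>0$ such that $$|\varphi(u)-\varphi(0)|\le K_1\|u\|^2+K_2\|u\|\quad\text{for all }u\in U\text{ with }\|u\|\le\delta\text{ and }\varphi(u)\le\varphi(0),$$ and such that for every multiplier $\lambda$ and every $\rho>\max\{K_1\delta+K_2,\ \|\lambda\|+(z_{IP}-z_R)/\delta\}$ one has $z_{SALR}(\rho)=z_{IP}$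 and $z^{LD+}_\rho(\|\cdot\|)=z_{IP}$. -/

import Mathlib

noncomputable section

open scoped Matrix

/-- Points of `ℝⁿ`, `n = n₁ + n₂`, split as `x = (x_I, x_C)`: `Sum.inl` indexes the integer
variables and `Sum.inr` the continuous ones. -/
abbrev MixedVec (n₁ n₂ : ℕ) : Type := Fin n₁ ⊕ Fin n₂ → ℝ

/-- The Euclidean space `ℝᵐ` of perturbations and multipliers of the dualized constraints. -/
abbrev RHSVec (m : ℕ) : Type := EuclideanSpace ℝ (Fin m)

/-- A rational vector, seen as a point of Euclidean space. -/
def ratVec {k : ℕ} (v : Fin k → ℚ) : EuclideanSpace ℝ (Fin k) :=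
  WithLp.toLp 2 (fun i => (v i : ℝ))

/-- The data of a mixed-integer quadratic program with rational coefficients:
minimize `½ xᵀ Q x - cᵀ x` subject to `A x = b`, `E x ≤ f`, `‖x_I‖_∞ ≤ M`,
`x = (x_I, x_C) ∈ ℤ^{n₁} × ℝ^{n₂}`. -/
structure MIQP (n₁ n₂ m p : ℕ) where
  /-- matrix of the (dualized) equality constraints -/
  A : Matrix (Fin m) (Fin n₁ ⊕ Fin n₂) ℚ
  /-- matrix of the inequality constraints -/
  E : Matrix (Fin p) (Fin n₁ ⊕ Fin n₂) ℚ
  /-- matrix of the quadratic form -/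
  Q : Matrix (Fin n₁ ⊕ Fin n₂) (Fin n₁ ⊕ Fin n₂) ℚ
  /-- linear part of the objective -/
  c : Fin n₁ ⊕ Fin n₂ → ℚ
  /-- bound on the integer variables -/
  M : ℝ
  /-- right-hand side of the equality constraints -/
  b : Fin m → ℚ
  /-- right-hand side of the inequality constraints -/
  f : Fin p → ℚ

namespace MIQP

variable {n₁ n₂ m p : ℕ} (P : MIQP n₁ n₂ m p)

/-- The objective `½ xᵀ Q x - cᵀ x`. For symmetric `Q` this is
`½ x_Cᵀ Q_CC x_C + ½ x_Iᵀ Q_II x_I + x_Iᵀ Q_IC x_C - c_Iᵀ x_I - c_Cᵀ x_C`. -/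
def obj (x : MixedVec n₁ n₂) : ℝ :=
  (1 / 2) * (x ⬝ᵥ (P.Q.map (fun q : ℚ => (q : ℝ)) *ᵥ x)) - (fun j => (P.c j : ℝ)) ⬝ᵥ x

/-- `A x`, as a point of Euclidean space. -/
def lhs (x : MixedVec n₁ n₂) : RHSVec m :=
  WithLp.toLp 2 (P.A.map (fun q : ℚ => (q : ℝ)) *ᵥ x)

/-- The violation `b - A x` of the dualized constraints. -/
def residual (x : MixedVec n₁ n₂) : RHSVec m := ratVec P.b - P.lhs x

/-- `X_R`: the continuous relaxation of `X`. -/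
def relaxSet : Set (MixedVec n₁ n₂) :=
  {x | (∀ k, (P.E.map (fun q : ℚ => (q : ℝ)) *ᵥ x) k ≤ (P.f k : ℝ)) ∧
       ∀ i : Fin n₁, |x (Sum.inl i)| ≤ P.M}

/-- `X`: the mixed-integer points satisfying `E x ≤ f` and `‖x_I‖_∞ ≤ M`. -/
def mixedSet : Set (MixedVec n₁ n₂) :=
  {x | x ∈ P.relaxSet ∧ ∀ i : Fin n₁, ∃ z : ℤ, x (Sum.inl i) = (z : ℝ)}

/-- `H_u = {x | A x = b + u}`. -/
def hyperplane (u : RHSVec m) : Set (MixedVec n₁ n₂) :=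
  {x | P.lhs x = ratVec P.b + u}

/-- `U`: the perturbations `u` for which the perturbed program is feasible. -/
def perturbations : Set (RHSVec m) := {u | (P.mixedSet ∩ P.hyperplane u).Nonempty}

/-- The value function `φ(u) = inf {f(x) | x ∈ X, A x = b + u}`, in the extended reals. -/
def value (u : RHSVec m) : EReal :=
  ⨅ x ∈ P.mixedSet ∩ P.hyperplane u, ((P.obj x : ℝ) : EReal)

/-- The optimal value `z_IP` of the program. -/
def optValue : EReal :=
  ⨅ x ∈ {x | x ∈ P.mixedSet ∧ P.lhs x = ratVec P.b}, ((P.obj x : ℝ) : EReal)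

/-- The optimal value `z_R` of the continuous relaxation. -/
def relaxValue : EReal :=
  ⨅ x ∈ {x | x ∈ P.relaxSet ∧ P.lhs x = ratVec P.b}, ((P.obj x : ℝ) : EReal)

/-- The augmented Lagrangian relaxation with augmenting function `ψ`:
`z_ρ^{LR+}(λ) = inf {f(x) + λᵀ(b - A x) + ρ ψ(b - A x) | x ∈ X}`. -/
def augRelaxation (ψ : RHSVec m → ℝ) (ρ : ℝ) (lam : RHSVec m) : EReal :=
  ⨅ x ∈ P.mixedSet,
    ((P.obj x + inner ℝ lam (P.residual x) + ρ * ψ (P.residual x) : ℝ) : EReal)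

/-- The augmented Lagrangian dual `z_ρ^{LD+} = sup_λ z_ρ^{LR+}(λ)`. -/
def augDual (ψ : RHSVec m → ℝ) (ρ : ℝ) : EReal :=
  ⨆ lam : RHSVec m, P.augRelaxation ψ ρ lam

/-- `ψ` has an exact penalty representation: the dual closes the gap for some finite `ρ > 0`. -/
def HasExactPenalty (ψ : RHSVec m → ℝ) : Prop :=
  ∃ ρ : ℝ, 0 < ρ ∧ P.augDual ψ ρ = P.optValue

/-- `z_SALR(ρ) = inf {f(x) + ρ ‖b - A x‖ | x ∈ X}`, the sharp augmented Lagrangian relaxation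
(Euclidean norm, no linear term). -/
def sharpRelaxation (ρ : ℝ) : EReal :=
  ⨅ x ∈ P.mixedSet, ((P.obj x + ρ * ‖P.residual x‖ : ℝ) : EReal)

/-- `lam` is a Lagrange multiplier of the continuous relaxation for the constraints `A x = b`:
the Lagrangian `f(x) + λᵀ(b - A x)` is at least `z_R` on all of `X_R`. -/
def IsRelaxMultiplier (lam : RHSVec m) : Prop :=
  ∀ x ∈ P.relaxSet, P.relaxValue ≤ ((P.obj x + inner ℝ lam (P.residual x) : ℝ) : EReal)

end MIQP

end

/-! Bounding `x_I` leaves finitely many integer parts, so the feasible set is a finite union of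
polyhedra (fibers) on which the objective is a convex quadratic. The argument is a perturbation
analysis of convex quadratic programs, uniform in the right-hand sides, followed by a comparison of
small and large residuals.

The polyhedral input is a quantitative Fourier–Motzkin elimination (`hasCertificates`). It yields
controlled solutions, Hoffman's bound, closedness of the set of solvable right-hand sides, and an
affine Farkas lemma. Finiteness of `z_R` excludes a recession direction that keeps `x_I` and `A x`,
lies in the kernel of `Q` and lowers the objective. This condition does not involve `b` or `f`. By
Farkas it becomes an inequality showing that every feasible point is dominated by one of size `O(1 +
s)`, where `s` bounds the right-hand sides (`exists_small_dominating`). Compactness then gives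
minimizers. Moving a dominating point by Hoffman's bound changes the objective by at most `K₁ r² +
K₂ (1 + s) r` (`quad_perturbation_bound`).

For small `u`, a fiber feasible at `u` is feasible at `0`, since solvability is a closed condition
and only finitely many fibers occur (`exists_fiber_radius`). Hence `φ(0) - φ(u)` is at most
quadratic plus linear in `‖u‖`. In `le_obj_add_penalty` this bound handles residuals of norm at most
`δ`; beyond `δ` a multiplier of the relaxation bounds the objective below, and the gap `z_IP - z_R`
is paid for by `‖r‖ > δ`. Other norms dominate a multiple of the Euclidean one. -/

open scoped Matrix

/-! ### Linear inequality systems: Fourier–Motzkin certificates, Hoffman's bound, Farkas' lemma. -/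

section LinearSystems

/-- Finitely many lower bounds below finitely many upper bounds leave room for a point, which can
be taken of size at most `B` if the lower bounds are at most `B` and the upper ones at least
`-B`. -/
theorem exists_between_bounds {α β : Type*} [Finite α] (L : α → ℝ) (U : β → ℝ) (B : ℝ)
    (hB : 0 ≤ B) (hLU : ∀ a b, L a ≤ U b) (hL : ∀ a, L a ≤ B) (hU : ∀ b, -B ≤ U b) :
    ∃ x, (∀ a, L a ≤ x) ∧ (∀ b, x ≤ U b) ∧ |x| ≤ B := by
  classical
  cases nonempty_fintype α
  -- Including `-B` covers the case of no lower bounds and keeps the maximum at least `-B`.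
  have hne : (insert (-B) (Finset.univ.image L)).Nonempty := Finset.insert_nonempty _ _
  refine ⟨(insert (-B) (Finset.univ.image L)).max' hne, fun a => ?_, fun b => ?_, ?_⟩
  · exact Finset.le_max' _ _ (by simp)
  · refine Finset.max'_le _ _ _ fun y hy => ?_
    rcases Finset.mem_insert.1 hy with rfl | hy
    · exact hU b
    · obtain ⟨a, -, rfl⟩ := Finset.mem_image.1 hy
      exact hLU a b
  · rw [abs_le]
    refine ⟨Finset.le_max' _ _ (by simp), Finset.max'_le _ _ _ fun y hy => ?_⟩
    rcases Finset.mem_insert.1 hy with rfl | hy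
    · linarith
    · obtain ⟨a, -, rfl⟩ := Finset.mem_image.1 hy
      exact hL a

/-- `|v · y| ≤ (∑ |v j|) R` when all `|y j| ≤ R`. -/
theorem abs_dotProduct_le {J : Type*} [Fintype J] (v y : J → ℝ) {R : ℝ} (hy : ∀ j, |y j| ≤ R) :
    |v ⬝ᵥ y| ≤ (∑ j, |v j|) * R := by
  rw [dotProduct, Finset.sum_mul]
  refine (Finset.abs_sum_le_sum_abs _ _).trans (Finset.sum_le_sum fun j _ => ?_)
  rw [abs_mul]
  exact mul_le_mul_of_nonneg_left (hy j) (abs_nonneg _)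

/-- The certificates produced by Fourier–Motzkin elimination: finitely many nonnegative
combinations of the rows of `G` decide the solvability of `G x ≤ g`, and a solvable system has a
solution of size at most `H` times the largest negative part of `g`. -/
def HasCertificates {ι J : Type} [Fintype ι] [Fintype J] (G : Matrix ι J ℝ) : Prop :=
  ∃ (κ : Type) (_ : Fintype κ) (Λ : κ → ι → ℝ) (H : ℝ), 0 ≤ H ∧ (∀ k i, 0 ≤ Λ k i) ∧
    (∀ k, Λ k ᵥ* G = 0) ∧ ∀ (g : ι → ℝ) (s : ℝ), 0 ≤ s → (∀ i, -s ≤ g i) →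
      (∀ k, 0 ≤ Λ k ⬝ᵥ g) → ∃ x : J → ℝ, (∀ i, (G *ᵥ x) i ≤ g i) ∧ ∀ j, |x j| ≤ H * s

/-- Induction on the number of variables, eliminating the first. Certificates of the reduced system
pull back along the elimination matrix, and a reduced solution extends by any value between the
resulting bounds on the eliminated variable. A lower bound on `g` suffices for the size estimate
because large entries of `g` only loosen constraints. -/
theorem hasCertificates_fin (n : ℕ) :
    ∀ (ι : Type) [Fintype ι] (G : Matrix ι (Fin n) ℝ), HasCertificates G := by
  classical
  induction n with
  | zero =>
    intro ι _ G
    refine ⟨ι, inferInstance, fun i => Pi.single i 1, 0, le_rfl, fun k i => ?_, fun k => ?_,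
      fun g s _ _ h => ⟨0, fun i => ?_, fun j => j.elim0⟩⟩
    · by_cases h : k = i
      · subst h; simp
      · simp [Ne.symm h]
    · ext j; exact j.elim0
    · simpa using h i
  | succ n ih =>
    intro ι _ G
    set a : ι → ℝ := fun i => G i 0 with ha
    set F : Matrix ι (Fin n) ℝ := fun i j => G i j.succ with hF
    -- The elimination matrix: it keeps rows free of the first variable, and for each pair of rows
    -- with coefficients of opposite sign adds the positive multiples that cancel it.
    let T : Matrix ({i // a i = 0} ⊕ ({i // 0 < a i} × {i // a i < 0})) ι ℝ := fun k =>
      Sum.elim (fun i => Pi.single i.1 1)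
        (fun ij => Pi.single ij.1.1 (a ij.1.1)⁻¹ + Pi.single ij.2.1 (-(a ij.2.1)⁻¹)) k
    have hTl : ∀ (i : {i // a i = 0}) (v : ι → ℝ), (T *ᵥ v) (Sum.inl i) = v i.1 := by
      intro i v; simp [T, Matrix.mulVec]
    have hTr : ∀ (ij : {i // 0 < a i} × {i // a i < 0}) (v : ι → ℝ),
        (T *ᵥ v) (Sum.inr ij) = (a ij.1.1)⁻¹ * v ij.1.1 + -(a ij.2.1)⁻¹ * v ij.2.1 := by
      intro i v
      change (Pi.single i.1.1 (a i.1.1)⁻¹ + Pi.single i.2.1 (-(a i.2.1)⁻¹)) ⬝ᵥ v = _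
      rw [add_dotProduct, single_dotProduct, single_dotProduct]
    have hT0 : ∀ k i, 0 ≤ T k i := by
      rintro (k | ⟨k, l⟩) i
      · simp only [T, Sum.elim_inl, Pi.single_apply]; split_ifs <;> norm_num
      · have h1 := inv_pos.2 k.2
        have h2 := inv_lt_zero.2 l.2
        simp only [T, Sum.elim_inr, Pi.add_apply, Pi.single_apply]
        split_ifs <;> linarith
    have hTa : T *ᵥ a = 0 := by
      ext (k | ⟨k, l⟩)
      · rw [hTl]; exact k.2
      · rw [hTr]
        simp [inv_mul_cancel₀ k.2.ne', inv_mul_cancel₀ l.2.ne]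
    obtain ⟨κ, _, Λ, H, hH, hΛ, hΛG, hsol⟩ := ih _ (T * F)
    set τ : ℝ := ∑ k, ∑ i, T k i
    have hτ : 0 ≤ τ := Finset.sum_nonneg fun k _ => Finset.sum_nonneg fun i _ => hT0 k i
    set σ : ℝ := ∑ i, ∑ j, |F i j|
    have hσ0 : 0 ≤ σ := Finset.sum_nonneg fun i _ => Finset.sum_nonneg fun j _ => abs_nonneg _
    set α : ℝ := ∑ i, |a i|⁻¹
    have hα0 : 0 ≤ α := Finset.sum_nonneg fun i _ => inv_nonneg.2 (abs_nonneg _)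
    have hα : ∀ i, |a i|⁻¹ ≤ α := fun i =>
      Finset.single_le_sum (f := fun i => |a i|⁻¹)
        (fun i _ => inv_nonneg.2 (abs_nonneg _)) (Finset.mem_univ i)
    refine ⟨κ, inferInstance, fun k => Λ k ᵥ* T, H * τ + α * (1 + σ * (H * τ)), by positivity,
      fun k i => Finset.sum_nonneg fun l _ => mul_nonneg (hΛ k l) (hT0 l i), fun k => ?_,
      fun g s hs hgs hg => ?_⟩
    · ext j
      refine Fin.cases ?_ (fun j => ?_) j
      · have : (Λ k ᵥ* T ᵥ* G) 0 = Λ k ᵥ* T ⬝ᵥ a := rfl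
        rw [this, ← Matrix.dotProduct_mulVec, hTa]; simp
      · have : (Λ k ᵥ* T ᵥ* G) j.succ = (Λ k ᵥ* T ᵥ* F) j := rfl
        rw [this, Matrix.vecMul_vecMul, hΛG]; rfl
    · obtain ⟨y, hy, hyb⟩ := hsol (T *ᵥ g) (τ * s) (by positivity) (fun k => by
        have h1 : ∑ i, T k i ≤ τ := Finset.single_le_sum (f := fun k => ∑ i, T k i)
          (fun k _ => Finset.sum_nonneg fun i _ => hT0 k i) (Finset.mem_univ k)
        have h2 : ∑ i, T k i * (-s) ≤ (T *ᵥ g) k :=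
          Finset.sum_le_sum fun i _ => mul_le_mul_of_nonneg_left (hgs i) (hT0 k i)
        rw [← Finset.sum_mul] at h2
        nlinarith) (fun k => by rw [Matrix.dotProduct_mulVec]; exact hg k)
      rw [← Matrix.mulVec_mulVec] at hy
      -- What remains for the first variable is `a i * x₀ ≤ r i`. Dividing by `a i` gives an upper
      -- or lower bound according to its sign; the paired rows of `T` say that these bounds are
      -- compatible.
      set r : ι → ℝ := fun i => g i - (F *ᵥ y) i with hr
      have hrb : ∀ i, -((1 + σ * (H * τ)) * s) ≤ r i := fun i => by
        have h1 := abs_dotProduct_le (F i) y hyb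
        have h2 : ∑ j, |F i j| ≤ σ := Finset.single_le_sum (f := fun i => ∑ j, |F i j|)
          (fun i _ => Finset.sum_nonneg fun j _ => abs_nonneg _) (Finset.mem_univ i)
        have h3 : (∑ j, |F i j|) * (H * (τ * s)) ≤ σ * (H * (τ * s)) :=
          mul_le_mul_of_nonneg_right h2 (by positivity)
        have h4 := (abs_le.1 h1).2
        have h5 := hgs i
        have h6 : (F *ᵥ y) i = F i ⬝ᵥ y := rfl
        simp only [hr]
        nlinarith
      have hB : 0 ≤ (1 + σ * (H * τ)) * s := by positivity
      obtain ⟨x₀, hl, hu, hx₀⟩ := exists_between_bounds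
        (fun j : {i // a i < 0} => r j.1 / a j.1) (fun i : {i // 0 < a i} => r i.1 / a i.1)
        (α * ((1 + σ * (H * τ)) * s)) (by positivity)
        (fun j i => by
          have := hy (Sum.inr (i, j))
          rw [hTr, hTr] at this
          simp only [hr, div_eq_inv_mul, mul_sub]
          linarith)
        (fun j => by
          have h1 := hrb j.1
          have h2 := hα j.1
          rw [abs_of_neg j.2] at h2
          have h3 : 0 < (-a j.1)⁻¹ := inv_pos.2 (neg_pos.2 j.2)
          have h4 : r j.1 / a j.1 = (-a j.1)⁻¹ * (-r j.1) := by
            rw [inv_neg, neg_mul_neg, div_eq_inv_mul]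
          rw [h4]
          exact (mul_le_mul_of_nonneg_left (by linarith) h3.le).trans
            (mul_le_mul_of_nonneg_right h2 hB))
        (fun i => by
          have h1 := hrb i.1
          have h2 := hα i.1
          rw [abs_of_pos i.2] at h2
          have h3 : 0 < (a i.1)⁻¹ := inv_pos.2 i.2
          rw [div_eq_inv_mul]
          have h5 := mul_le_mul_of_nonneg_left h1 h3.le
          have h6 := mul_le_mul_of_nonneg_right h2 hB
          linarith)
      refine ⟨Fin.cons x₀ y, fun i => ?_, fun j => ?_⟩
      · have h0 : (G *ᵥ (Fin.cons x₀ y : Fin (n + 1) → ℝ)) i = a i * x₀ + (F *ᵥ y) i := by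
          simp [Matrix.mulVec, dotProduct, Fin.sum_univ_succ, ha, hF]
        rw [h0]
        rcases lt_trichotomy (a i) 0 with h | h | h
        · have := (div_le_iff_of_neg h).1 (hl ⟨i, h⟩)
          simp only [hr] at this
          linarith
        · have := hy (Sum.inl ⟨i, h⟩)
          rw [hTl, hTl] at this
          rw [h]; linarith
        · have := (le_div_iff₀ h).1 (hu ⟨i, h⟩)
          simp only [hr] at this
          linarith
      · have h1 : 0 ≤ α * ((1 + σ * (H * τ)) * s) := by positivity
        have h2 : 0 ≤ H * (τ * s) := by positivity
        refine Fin.cases ?_ (fun j => ?_) j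
        · rw [Fin.cons_zero]; nlinarith
        · rw [Fin.cons_succ]; have := hyb j; nlinarith

theorem hasCertificates {ι J : Type} [Fintype ι] [Fintype J] (G : Matrix ι J ℝ) :
    HasCertificates G := by
  classical
  let e := Fintype.equivFin J
  obtain ⟨κ, _, Λ, H, hH, hΛ, hΛG, hsol⟩ :=
    hasCertificates_fin _ ι (G.submatrix id e.symm)
  refine ⟨κ, inferInstance, Λ, H, hH, hΛ, fun k => ?_, fun g s hs hgs hg => ?_⟩
  · ext j
    simpa [Matrix.vecMul, dotProduct] using congrFun (hΛG k) (e j)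
  · obtain ⟨x, hx, hxb⟩ := hsol g s hs hgs hg
    refine ⟨x ∘ e, fun i => ?_, fun j => hxb _⟩
    have : (G *ᵥ (x ∘ e)) i = (G.submatrix id e.symm *ᵥ x) i := by
      simp [Matrix.mulVec, dotProduct, ← e.symm.sum_comp]
    rw [this]; exact hx i

/-- The stacked inequality matrix of the system `G x ≤ g`, `B x = h`. -/
def stackRows {ι κ J : Type} (G : Matrix ι J ℝ) (B : Matrix κ J ℝ) :
    Matrix (ι ⊕ (κ ⊕ κ)) J ℝ :=
  Matrix.fromRows G (Matrix.fromRows B (-B))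

/-- The stacked right-hand side of the system `G x ≤ g`, `B x = h`. -/
def stackVec {ι κ : Type} (g : ι → ℝ) (h : κ → ℝ) : ι ⊕ (κ ⊕ κ) → ℝ :=
  Sum.elim g (Sum.elim h (-h))

/-- The solution set of `G x ≤ g`, `B x = h`. -/
def polySet {ι κ J : Type} [Fintype J] (G : Matrix ι J ℝ) (B : Matrix κ J ℝ) (g : ι → ℝ)
    (h : κ → ℝ) : Set (J → ℝ) :=
  {x | (∀ i, (G *ᵥ x) i ≤ g i) ∧ ∀ k, (B *ᵥ x) k = h k}

variable {ι κ J : Type} [Fintype J] (G : Matrix ι J ℝ) (B : Matrix κ J ℝ)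

theorem stackRows_mulVec_le {g : ι → ℝ} {h : κ → ℝ} {x : J → ℝ} :
    (∀ i, (stackRows G B *ᵥ x) i ≤ stackVec g h i) ↔ x ∈ polySet G B g h := by
  simp only [stackRows, stackVec, polySet, Matrix.fromRows_mulVec, Sum.forall, Sum.elim_inl,
    Sum.elim_inr, Matrix.neg_mulVec, Pi.neg_apply, neg_le_neg_iff, Set.mem_ofPred_eq]
  constructor
  · rintro ⟨h1, h2, h3⟩; exact ⟨h1, fun k => le_antisymm (h2 k) (h3 k)⟩
  · rintro ⟨h1, h2⟩; exact ⟨h1, fun k => (h2 k).le, fun k => (h2 k).ge⟩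

variable [Fintype ι] [Fintype κ]

/-- Every solvable system has a solution controlled by the right-hand side. -/
theorem exists_small_solution : ∃ H : ℝ, 0 ≤ H ∧ ∀ (g : ι → ℝ) (h : κ → ℝ) (s : ℝ), 0 ≤ s →
    (∀ i, -s ≤ g i) → (∀ k, |h k| ≤ s) → (polySet G B g h).Nonempty →
    ∃ x ∈ polySet G B g h, ∀ j, |x j| ≤ H * s := by
  obtain ⟨ℓ, _, Λ, H, hH, hΛ, hΛG, hsol⟩ := hasCertificates (stackRows G B)
  refine ⟨H, hH, fun g h s hs hg hh ⟨y, hy⟩ => ?_⟩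
  obtain ⟨x, hx, hxb⟩ := hsol (stackVec g h) s hs (by
    rintro (i | k | k)
    · exact hg i
    · exact (abs_le.1 (hh k)).1
    · exact neg_le_neg (abs_le.1 (hh k)).2) (fun k => by
      have h1 : Λ k ⬝ᵥ (stackRows G B *ᵥ y) = 0 := by
        rw [Matrix.dotProduct_mulVec, hΛG, zero_dotProduct]
      rw [← h1]
      exact Finset.sum_le_sum fun i _ =>
        mul_le_mul_of_nonneg_left ((stackRows_mulVec_le G B).2 hy i) (hΛ k i))
  exact ⟨x, (stackRows_mulVec_le G B).1 hx, hxb⟩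

/-- Hoffman's error bound. -/
theorem hoffman_bound : ∃ H : ℝ, 0 ≤ H ∧ ∀ (g : ι → ℝ) (h : κ → ℝ) (s : ℝ) (x : J → ℝ), 0 ≤ s →
    (∀ i, (G *ᵥ x) i - g i ≤ s) → (∀ k, |(B *ᵥ x) k - h k| ≤ s) → (polySet G B g h).Nonempty →
    ∃ y ∈ polySet G B g h, ∀ j, |y j - x j| ≤ H * s := by
  obtain ⟨H, hH, hsol⟩ := exists_small_solution G B
  refine ⟨H, hH, fun g h s x hs hg hh ⟨y, hy⟩ => ?_⟩
  -- The displacement from `x` solves the system whose right-hand side is the residual at `x`. Slack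
  -- constraints have positive residual there, so only violations enter the bound.
  obtain ⟨d, hd, hdb⟩ := hsol (g - G *ᵥ x) (h - B *ᵥ x) s hs
    (fun i => by have := hg i; simp only [Pi.sub_apply]; linarith)
    (fun k => by rw [Pi.sub_apply, abs_sub_comm]; exact hh k)
    ⟨y - x, fun i => by
      have := hy.1 i
      simp only [Matrix.mulVec_sub, Pi.sub_apply]; linarith, fun k => by
      have := hy.2 k
      simp only [Matrix.mulVec_sub, Pi.sub_apply]; linarith⟩
  refine ⟨x + d, ⟨fun i => ?_, fun k => ?_⟩, fun j => by simpa using hdb j⟩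
  · have := hd.1 i
    simp only [Matrix.mulVec_add, Pi.add_apply, Pi.sub_apply] at this ⊢; linarith
  · have := hd.2 k
    simp only [Matrix.mulVec_add, Pi.add_apply, Pi.sub_apply] at this ⊢; linarith

/-- The right-hand sides of solvable systems form a closed set. -/
theorem isClosed_solvable :
    IsClosed {gh : (ι → ℝ) × (κ → ℝ) | (polySet G B gh.1 gh.2).Nonempty} := by
  obtain ⟨ℓ, _, Λ, H, hH, hΛ, hΛG, hsol⟩ := hasCertificates (stackRows G B)
  have : {gh : (ι → ℝ) × (κ → ℝ) | (polySet G B gh.1 gh.2).Nonempty} =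
      ⋂ k, {gh | 0 ≤ Λ k ⬝ᵥ stackVec gh.1 gh.2} := by
    ext ⟨g, h⟩
    simp only [Set.mem_ofPred_eq, Set.mem_iInter]
    constructor
    · rintro ⟨y, hy⟩ k
      have h1 : Λ k ⬝ᵥ (stackRows G B *ᵥ y) = 0 := by
        rw [Matrix.dotProduct_mulVec, hΛG, zero_dotProduct]
      rw [← h1]
      exact Finset.sum_le_sum fun i _ =>
        mul_le_mul_of_nonneg_left ((stackRows_mulVec_le G B).2 hy i) (hΛ k i)
    · intro hk
      obtain ⟨x, hx, -⟩ := hsol (stackVec g h) (∑ i, |stackVec g h i|)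
        (Finset.sum_nonneg fun _ _ => abs_nonneg _)
        (fun i => (neg_le_neg (Finset.single_le_sum (f := fun i => |stackVec g h i|)
          (fun _ _ => abs_nonneg _) (Finset.mem_univ i))).trans (neg_abs_le _)) hk
      exact ⟨x, (stackRows_mulVec_le G B).1 hx⟩
  rw [this]
  refine isClosed_iInter fun k => isClosed_le continuous_const ?_
  simp only [dotProduct]
  refine continuous_finsetSum _ fun i _ => continuous_const.mul ?_
  rcases i with i | i | i <;> simp only [stackVec, Sum.elim_inl, Sum.elim_inr] <;> fun_prop

/-- The affine Farkas lemma: a valid linear inequality on a nonempty polyhedron is a nonnegative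
combination of the defining ones. -/
theorem affine_farkas {g : ι → ℝ} {h : κ → ℝ} (hne : (polySet G B g h).Nonempty) (a : J → ℝ)
    (β : ℝ) (hv : ∀ x ∈ polySet G B g h, β ≤ a ⬝ᵥ x) :
    ∃ (μ : ι → ℝ) (ν : κ → ℝ), (∀ i, 0 ≤ μ i) ∧ μ ᵥ* G + ν ᵥ* B + a = 0 ∧
      μ ⬝ᵥ g + ν ⬝ᵥ h + β ≤ 0 := by
  obtain ⟨ℓ, _, Λ, H, hH, hΛ, hΛG, hsol⟩ :=
    hasCertificates (Matrix.fromRows (stackRows G B) (Matrix.replicateRow Unit a))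
  have hsplit : ∀ k t, Λ k ⬝ᵥ Sum.elim (stackVec g h) (fun _ : Unit => t) =
      (Λ k ∘ Sum.inl) ⬝ᵥ stackVec g h + Λ k (Sum.inr ()) * t := fun k t => by
    simp [dotProduct, Fintype.sum_sum_type]
  have hcol : ∀ k, (Λ k ∘ Sum.inl) ᵥ* stackRows G B + Λ k (Sum.inr ()) • a = 0 := fun k => by
    rw [← hΛG k, Matrix.vecMul_fromRows]
    congr 1
    ext j
    simp [Matrix.vecMul, dotProduct]
  obtain ⟨y, hy⟩ := hne
  have key : ∃ k, 0 < Λ k (Sum.inr ()) ∧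
      (Λ k ∘ Sum.inl) ⬝ᵥ stackVec g h + Λ k (Sum.inr ()) * β ≤ 0 := by
    -- Otherwise the bound could be lowered to `β - ε` with all certificates still satisfied: those
    -- with positive weight on the row `a` by continuity, those with zero weight because `y` is
    -- feasible. A solution would then violate `hv`. The certificate found is later normalized to
    -- weight one on `a`.
    by_contra! hcon
    have hev : ∀ᶠ ε in nhdsWithin (0 : ℝ) (Set.Ioi 0), ∀ k,
        0 ≤ (Λ k ∘ Sum.inl) ⬝ᵥ stackVec g h + Λ k (Sum.inr ()) * (β - ε) := by
      refine Filter.eventually_all.2 fun k => ?_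
      rcases (hΛ k (Sum.inr ())).eq_or_lt with h0 | h0
      · refine Filter.Eventually.of_forall fun ε => ?_
        have h1 := hcol k
        rw [← h0, zero_smul, add_zero] at h1
        have h2 : (Λ k ∘ Sum.inl) ⬝ᵥ (stackRows G B *ᵥ y) = 0 := by
          rw [Matrix.dotProduct_mulVec, h1, zero_dotProduct]
        rw [← h0, zero_mul, add_zero, ← h2]
        exact Finset.sum_le_sum fun i _ =>
          mul_le_mul_of_nonneg_left ((stackRows_mulVec_le G B).2 hy i) (hΛ k _)
      · have h1 := hcon k h0
        have hc : Continuous fun ε : ℝ =>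
          (Λ k ∘ Sum.inl) ⬝ᵥ stackVec g h + Λ k (Sum.inr ()) * (β - ε) := by fun_prop
        have h2 := hc.continuousAt (x := 0)
        filter_upwards [(h2.eventually (lt_mem_nhds (by simpa using h1))).filter_mono
          nhdsWithin_le_nhds] with ε hε using hε.le
    obtain ⟨ε, hε, hε0⟩ := (hev.and self_mem_nhdsWithin).exists
    obtain ⟨x, hx, -⟩ := hsol (Sum.elim (stackVec g h) (fun _ : Unit => β - ε))
      (∑ i, |Sum.elim (stackVec g h) (fun _ : Unit => β - ε) i|)
      (Finset.sum_nonneg fun _ _ => abs_nonneg _)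
      (fun i => (neg_le_neg (Finset.single_le_sum
          (f := fun i => |Sum.elim (stackVec g h) (fun _ : Unit => β - ε) i|)
          (fun _ _ => abs_nonneg _) (Finset.mem_univ i))).trans (neg_abs_le _))
      (fun k => by rw [hsplit]; exact hε k)
    rw [Matrix.fromRows_mulVec] at hx
    have h1 := hv x ((stackRows_mulVec_le G B).1 fun i => hx (Sum.inl i))
    have h2 : a ⬝ᵥ x ≤ β - ε := hx (Sum.inr ())
    have h3 : 0 < ε := hε0
    linarith
  obtain ⟨k, hk, hkβ⟩ := key
  set τ := Λ k (Sum.inr ())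
  refine ⟨fun i => τ⁻¹ * Λ k (Sum.inl (Sum.inl i)),
    fun l => τ⁻¹ * (Λ k (Sum.inl (Sum.inr (Sum.inl l))) - Λ k (Sum.inl (Sum.inr (Sum.inr l)))),
    fun i => mul_nonneg (inv_nonneg.2 hk.le) (hΛ _ _), ?_, ?_⟩
  · ext j
    have h1 := congrFun (hcol k) j
    have h2 : ∀ u v w t : ℝ, u + (v - w) + τ * t = 0 → τ⁻¹ * u + (τ⁻¹ * (v - w)) + t = 0 := by
      intro u v w t h
      field_simp
      linarith
    simp only [stackRows, Matrix.vecMul_fromRows, Matrix.vecMul, dotProduct, Pi.add_apply,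
      Function.comp_apply, Pi.smul_apply, smul_eq_mul, Pi.zero_apply, Matrix.neg_apply,
      mul_neg, Finset.sum_neg_distrib, ← sub_eq_add_neg] at h1 ⊢
    simp only [mul_assoc, ← Finset.mul_sum, sub_mul, Finset.sum_sub_distrib]
    exact h2 _ _ _ _ h1
  · have h2 : ∀ u v w : ℝ, u + (v - w) + τ * β ≤ 0 → τ⁻¹ * u + (τ⁻¹ * (v - w)) + β ≤ 0 := by
      intro u v w h
      have : τ⁻¹ * (u + (v - w) + τ * β) ≤ 0 :=
        mul_nonpos_of_nonneg_of_nonpos (inv_nonneg.2 hk.le) h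
      have h3 : τ⁻¹ * (τ * β) = β := by field_simp
      nlinarith
    simp only [stackVec, dotProduct, Fintype.sum_sum_type, Function.comp_apply, Sum.elim_inl,
      Sum.elim_inr, Pi.neg_apply, mul_neg, Finset.sum_neg_distrib, ← sub_eq_add_neg] at hkβ ⊢
    simp only [mul_assoc, ← Finset.mul_sum, sub_mul, Finset.sum_sub_distrib]
    exact h2 _ _ _ hkβ

end LinearSystems

/-! ### Convex quadratic programs: growth control, existence of minimizers, perturbation,
multipliers. -/

section ConvexQuadratic

variable {ι κ J : Type} [Fintype J]

/-- The quadratic function `½ xᵀ Q x - cᵀ x`. -/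
noncomputable def quad (Q : Matrix J J ℝ) (c x : J → ℝ) : ℝ := (1 / 2) * (x ⬝ᵥ (Q *ᵥ x)) - c ⬝ᵥ x

theorem continuous_quad (Q : Matrix J J ℝ) (c : J → ℝ) : Continuous (quad Q c) := by
  unfold quad
  simp only [dotProduct, Matrix.mulVec]
  fun_prop

theorem isClosed_polySet (G : Matrix ι J ℝ) (B : Matrix κ J ℝ) (g : ι → ℝ) (h : κ → ℝ) :
    IsClosed (polySet G B g h) := by
  have : polySet G B g h =
      (⋂ i, {x | (G *ᵥ x) i ≤ g i}) ∩ ⋂ k, {x | (B *ᵥ x) k = h k} := by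
    ext x; simp [polySet]
  rw [this]
  refine (isClosed_iInter fun i => isClosed_le ?_ continuous_const).inter
    (isClosed_iInter fun k => isClosed_eq ?_ continuous_const)
  all_goals simp only [dotProduct, Matrix.mulVec]; fun_prop

theorem dotProduct_mulVec_symm {Q : Matrix J J ℝ} (hQ : Q.PosSemidef) (v x : J → ℝ) :
    v ⬝ᵥ (Q *ᵥ x) = x ⬝ᵥ (Q *ᵥ v) := by
  have hs : Qᵀ = Q := by simpa using hQ.isHermitian.eq
  rw [Matrix.dotProduct_mulVec, ← Matrix.mulVec_transpose, hs, dotProduct_comm]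

theorem quadForm_nonneg {Q : Matrix J J ℝ} (hQ : Q.PosSemidef) (x : J → ℝ) :
    0 ≤ x ⬝ᵥ (Q *ᵥ x) := by
  simpa using hQ.dotProduct_mulVec_nonneg x

theorem quad_add {Q : Matrix J J ℝ} (hQ : Q.PosSemidef) (c x d : J → ℝ) :
    quad Q c (x + d) = quad Q c x + (Q *ᵥ x - c) ⬝ᵥ d + (1 / 2) * (d ⬝ᵥ (Q *ᵥ d)) := by
  have h1 := dotProduct_mulVec_symm hQ x d
  have h2 := dotProduct_comm d (Q *ᵥ x)
  simp only [quad, Matrix.mulVec_add, dotProduct_add, add_dotProduct, sub_dotProduct]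
  linarith

/-- Young's inequality for a positive semidefinite form. -/
theorem two_mul_dotProduct_mulVec_le {Q : Matrix J J ℝ} (hQ : Q.PosSemidef) (v x : J → ℝ) :
    2 * (v ⬝ᵥ (Q *ᵥ x)) ≤ v ⬝ᵥ (Q *ᵥ v) + x ⬝ᵥ (Q *ᵥ x) := by
  have h1 := quadForm_nonneg hQ (v - x)
  have h2 := dotProduct_mulVec_symm hQ v x
  simp only [Matrix.mulVec_sub, dotProduct_sub, sub_dotProduct] at h1
  linarith

theorem abs_dotProduct_mulVec_le (Q : Matrix J J ℝ) {v x : J → ℝ} {a b : ℝ} (ha : 0 ≤ a)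
    (hv : ∀ j, |v j| ≤ a) (hx : ∀ j, |x j| ≤ b) :
    |v ⬝ᵥ (Q *ᵥ x)| ≤ (∑ i, ∑ j, |Q i j|) * (a * b) := by
  rw [dotProduct_comm]
  refine (abs_dotProduct_le _ v hv).trans ?_
  have : ∑ j, |(Q *ᵥ x) j| ≤ (∑ i, ∑ j, |Q i j|) * b := by
    rw [Finset.sum_mul]
    exact Finset.sum_le_sum fun i _ => abs_dotProduct_le (Q i) x hx
  calc _ ≤ (∑ i, ∑ j, |Q i j|) * b * a := mul_le_mul_of_nonneg_right this ha
    _ = _ := by ring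

/-- The linear part does not decrease along recession directions on which the quadratic part is
constant. -/
def RecessionCondition (G : Matrix ι J ℝ) (B : Matrix κ J ℝ) (Q : Matrix J J ℝ) (c : J → ℝ) :
    Prop :=
  ∀ d : J → ℝ, (∀ i, (G *ᵥ d) i ≤ 0) → (∀ k, (B *ᵥ d) k = 0) → Q *ᵥ d = 0 → c ⬝ᵥ d ≤ 0

variable [Fintype ι] [Fintype κ] {G : Matrix ι J ℝ} {B : Matrix κ J ℝ} {Q : Matrix J J ℝ}
  {c : J → ℝ}

/-- Farkas certificate for the recession condition. -/
theorem RecessionCondition.exists_bound (hrc : RecessionCondition G B Q c) :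
    ∃ (N : ℝ) (w : J → ℝ), 0 ≤ N ∧ ∀ (g : ι → ℝ) (h : κ → ℝ) (s : ℝ),
      (∀ i, |g i| ≤ s) → (∀ k, |h k| ≤ s) → ∀ x ∈ polySet G B g h,
        c ⬝ᵥ x ≤ N * s + w ⬝ᵥ (Q *ᵥ x) := by
  -- Treating `Q d = 0` as further equations writes `c` as a combination of rows of `G`, `B` and
  -- `Q`; the multiplier of the `Q` rows is `w`.
  obtain ⟨μ, ν, hμ, heq, -⟩ := affine_farkas G (Matrix.fromRows B Q) (g := 0) (h := 0)
    ⟨0, by simp [polySet]⟩ (-c) 0 (fun d hd => by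
      have := hrc d hd.1 (fun k => by simpa [Matrix.fromRows_mulVec] using hd.2 (Sum.inl k))
        (by ext j; simpa [Matrix.fromRows_mulVec] using hd.2 (Sum.inr j))
      rw [neg_dotProduct]; linarith)
  refine ⟨(∑ i, |μ i|) + ∑ k, |ν (Sum.inl k)|, fun j => ν (Sum.inr j),
    add_nonneg (Finset.sum_nonneg fun _ _ => abs_nonneg _)
      (Finset.sum_nonneg fun _ _ => abs_nonneg _), fun g h s hg hh x hx => ?_⟩
  have hc : c = μ ᵥ* G + ν ᵥ* Matrix.fromRows B Q := by
    rw [← sub_eq_add_neg, sub_eq_zero] at heq; exact heq.symm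
  have h1 : c ⬝ᵥ x = μ ⬝ᵥ (G *ᵥ x) + ((fun k => ν (Sum.inl k)) ⬝ᵥ (B *ᵥ x) +
      (fun j => ν (Sum.inr j)) ⬝ᵥ (Q *ᵥ x)) := by
    rw [hc, add_dotProduct, ← Matrix.dotProduct_mulVec, ← Matrix.dotProduct_mulVec,
      Matrix.fromRows_mulVec]
    simp [dotProduct, Fintype.sum_sum_type]
  have h2 : μ ⬝ᵥ (G *ᵥ x) ≤ μ ⬝ᵥ g :=
    Finset.sum_le_sum fun i _ => mul_le_mul_of_nonneg_left (hx.1 i) (hμ i)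
  have h3 := (abs_le.1 (abs_dotProduct_le μ g hg)).2
  have h4 : B *ᵥ x = h := funext hx.2
  have h5 := (abs_le.1 (abs_dotProduct_le (fun k => ν (Sum.inl k)) h hh)).2
  rw [h1, h4, add_mul]
  linarith

/-- Every feasible point is dominated by one whose size is controlled by the right-hand side. -/
theorem exists_small_dominating (hQ : Q.PosSemidef) (hrc : RecessionCondition G B Q c) :
    ∃ C : ℝ, 0 ≤ C ∧ ∀ (g : ι → ℝ) (h : κ → ℝ) (s : ℝ), 0 ≤ s → (∀ i, |g i| ≤ s) →
      (∀ k, |h k| ≤ s) → ∀ x ∈ polySet G B g h,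
        ∃ y ∈ polySet G B g h, quad Q c y ≤ quad Q c x ∧ ∀ j, |y j| ≤ C * (1 + s) := by
  classical
  obtain ⟨H, hH, hsmall⟩ := exists_small_solution G B
  obtain ⟨H', hH', hsmall'⟩ := exists_small_solution
    (Matrix.fromRows G (Matrix.replicateRow Unit (-c))) (Matrix.fromRows B Q)
  obtain ⟨N, w, hN, hbound⟩ := hrc.exists_bound
  set σ : ℝ := ∑ i, ∑ j, |Q i j|
  have hσ : 0 ≤ σ := Finset.sum_nonneg fun i _ => Finset.sum_nonneg fun j _ => abs_nonneg _
  set γ : ℝ := ∑ j, |c j|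
  have hγ : 0 ≤ γ := Finset.sum_nonneg fun i _ => abs_nonneg _
  set ω : ℝ := ∑ j, |w j|
  have hω : 0 ≤ ω := Finset.sum_nonneg fun i _ => abs_nonneg _
  set W : ℝ := w ⬝ᵥ (Q *ᵥ w)
  have hW : 0 ≤ W := quadForm_nonneg hQ w
  set D : ℝ := 4 * (σ * (H * H) + γ * H + N + W)
  have hD : 0 ≤ D := by positivity
  set D₁ : ℝ := D + ∑ j, |Q j j|
  have hD₁ : 0 ≤ D₁ := add_nonneg hD (Finset.sum_nonneg fun _ _ => abs_nonneg _)
  set S : ℝ := 1 + D₁ + N + ω * D₁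
  have hS : 0 ≤ S := by positivity
  refine ⟨H + H' * S, by positivity, fun g h s hs hg hh x hx => ?_⟩
  obtain ⟨t, ht⟩ : ∃ t, t = 1 + s := ⟨_, rfl⟩
  rw [← ht]
  have ht1 : 1 ≤ t := by linarith
  have ht0 : 0 < t := by linarith
  have htt : t ≤ t ^ 2 := by nlinarith
  obtain ⟨x₀, hx₀, hx₀b⟩ := hsmall g h s hs (fun i => (abs_le.1 (hg i)).1) hh ⟨x, hx⟩
  have hx₀t : ∀ j, |x₀ j| ≤ H * t := fun j => (hx₀b j).trans (by nlinarith)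
  by_cases hle : quad Q c x₀ ≤ quad Q c x
  · exact ⟨x₀, hx₀, hle, fun j => (hx₀t j).trans
      (by nlinarith [mul_nonneg (mul_nonneg hH' hS) ht0.le])⟩
  -- Now `x` beats the small point `x₀`, so its objective is `O(t²)`. This is used to bound
  -- successively the form at `x`, the vector `Q x`, and `c ⬝ᵥ x` from above.
  push Not at hle
  have e1 := (abs_le.1 (abs_dotProduct_mulVec_le Q (by positivity) hx₀t hx₀t)).2
  have e2 := (abs_le.1 (abs_dotProduct_le c x₀ hx₀t)).1
  have e3 := hbound g h s hg hh x hx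
  -- The factor `2` leaves only a quarter of the form at `x` on the right, which half the form in
  -- the objective absorbs.
  have e4 := two_mul_dotProduct_mulVec_le hQ ((2 : ℝ) • w) x
  have e5 := quadForm_nonneg hQ x
  simp only [smul_dotProduct, Matrix.mulVec_smul, dotProduct_smul, smul_eq_mul] at e4
  change _ ≤ 2 * (2 * W) + _ at e4
  change _ ≤ σ * _ at e1
  change -(γ * _) ≤ _ at e2
  have hform : x ⬝ᵥ (Q *ᵥ x) ≤ D * t ^ 2 := by
    have hq := hle
    simp only [quad] at hq
    have f1 : γ * (H * t) ≤ γ * H * t ^ 2 := by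
      rw [← mul_assoc]; exact mul_le_mul_of_nonneg_left htt (by positivity)
    have f2 : N * s ≤ N * t ^ 2 := mul_le_mul_of_nonneg_left (by linarith) hN
    have f3 : W ≤ W * t ^ 2 := le_mul_of_one_le_right hW (by nlinarith)
    have f4 : σ * (H * t * (H * t)) = σ * (H * H) * t ^ 2 := by ring
    have f5 : 0 ≤ σ * (H * H) * t ^ 2 := by positivity
    have f6 : D * t ^ 2 = 4 * (σ * (H * H) * t ^ 2 + γ * H * t ^ 2 + N * t ^ 2 + W * t ^ 2) := by
      ring
    rw [f6]
    linarith
  have hQx : ∀ j, |(Q *ᵥ x) j| ≤ D₁ * t := by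
    intro j
    have hsc : ∀ ε : ℝ, ε ^ 2 = 1 → ε * (Q *ᵥ x) j ≤ D₁ * t := by
      intro ε hε
      -- Scaling `x` by `t⁻¹` turns the quadratic bound on the form into a linear bound on `Q x`.
      have g1 := two_mul_dotProduct_mulVec_le hQ (Pi.single j ε) (t⁻¹ • x)
      have g2 : (Pi.single j ε : J → ℝ) ⬝ᵥ (Q *ᵥ Pi.single j ε) = ε ^ 2 * Q j j := by
        simp [single_dotProduct, Matrix.mulVec_single]; ring
      have g3 : t⁻¹ * (t⁻¹ * (x ⬝ᵥ (Q *ᵥ x))) ≤ D := by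
        have : t⁻¹ * (t⁻¹ * (D * t ^ 2)) = D := by field_simp
        rw [← this]; gcongr
      have g4 : |Q j j| ≤ ∑ j, |Q j j| := Finset.single_le_sum (f := fun j => |Q j j|)
        (fun _ _ => abs_nonneg _) (Finset.mem_univ j)
      have g5 := le_abs_self (Q j j)
      rw [g2, hε] at g1
      simp only [smul_dotProduct, Matrix.mulVec_smul, dotProduct_smul, smul_eq_mul,
        single_dotProduct] at g1
      have g6 : t⁻¹ * (ε * (Q *ᵥ x) j) ≤ D₁ := by
        simp only [D₁]; linarith
      have g7 : ε * (Q *ᵥ x) j = t⁻¹ * (ε * (Q *ᵥ x) j) * t := by field_simp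
      rw [g7]; exact mul_le_mul_of_nonneg_right g6 ht0.le
    rw [abs_le]
    have h1 := hsc 1 (by norm_num)
    have h2 := hsc (-1) (by norm_num)
    constructor <;> linarith
  have hcx : c ⬝ᵥ x ≤ S * t := by
    have h1 := (abs_le.1 (abs_dotProduct_le w _ hQx)).2
    change _ ≤ ω * _ at h1
    have h2 : N * s ≤ N * t := mul_le_mul_of_nonneg_left (by linarith) hN
    have h3 : S * t = t + D₁ * t + N * t + ω * (D₁ * t) := by simp only [S]; ring
    have h4 : 0 ≤ D₁ * t := by positivity
    rw [h3]; linarith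
  have hst : s ≤ S * t := by
    have : 1 * t ≤ S * t := mul_le_mul_of_nonneg_right (by
      have : 0 ≤ ω * D₁ := by positivity
      simp only [S]; linarith) ht0.le
    linarith
  have hDt : D₁ * t ≤ S * t := mul_le_mul_of_nonneg_right (by
      have : 0 ≤ ω * D₁ := by positivity
      simp only [S]; linarith) ht0.le
  -- Any `y` in the polyhedron with `Q y = Q x` and `c ⬝ᵥ y ≥ c ⬝ᵥ x` has objective at most that of
  -- `x`. Since inequality data need only be bounded below, an upper bound on `c ⬝ᵥ x` is enough for
  -- a small such `y`.
  obtain ⟨y, hy, hyb⟩ := hsmall' (Sum.elim g fun _ => -(c ⬝ᵥ x)) (Sum.elim h (Q *ᵥ x)) (S * t)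
    (by positivity)
    (by
      rintro (i | i)
      · exact (neg_le_neg hst).trans (abs_le.1 (hg i)).1
      · exact neg_le_neg hcx)
    (by
      rintro (k | j)
      · exact (hh k).trans hst
      · exact (hQx j).trans hDt)
    ⟨x, by
      rw [polySet]
      simp only [Matrix.fromRows_mulVec]
      refine ⟨?_, ?_⟩
      · rintro (i | i)
        · exact hx.1 i
        · exact (neg_dotProduct c x).le
      · rintro (k | j)
        · exact hx.2 k
        · rfl⟩
  rw [polySet] at hy
  simp only [Matrix.fromRows_mulVec] at hy
  have hQy : Q *ᵥ y = Q *ᵥ x := funext fun j => hy.2 (Sum.inr j)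
  have hcy : -c ⬝ᵥ y ≤ -(c ⬝ᵥ x) := hy.1 (Sum.inr ())
  refine ⟨y, ⟨fun i => hy.1 (Sum.inl i), fun k => hy.2 (Sum.inl k)⟩, ?_, fun j => ?_⟩
  · rw [neg_dotProduct] at hcy
    rw [quad, quad, hQy, dotProduct_mulVec_symm hQ y x, hQy]
    linarith
  · refine (hyb j).trans ?_
    have : 0 ≤ H * t := by positivity
    nlinarith

/-- A convex quadratic program satisfying the recession condition attains its minimum. -/
theorem exists_minimizer (hQ : Q.PosSemidef) (hrc : RecessionCondition G B Q c) {g : ι → ℝ}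
    {h : κ → ℝ} (hne : (polySet G B g h).Nonempty) :
    ∃ x ∈ polySet G B g h, ∀ y ∈ polySet G B g h, quad Q c x ≤ quad Q c y := by
  obtain ⟨C, hC, hdom⟩ := exists_small_dominating hQ hrc
  set s : ℝ := (∑ i, |g i|) + ∑ k, |h k|
  have h1 : 0 ≤ ∑ i, |g i| := Finset.sum_nonneg fun _ _ => abs_nonneg _
  have h2 : 0 ≤ ∑ k, |h k| := Finset.sum_nonneg fun _ _ => abs_nonneg _
  have hg : ∀ i, |g i| ≤ s := fun i => by
    have := Finset.single_le_sum (f := fun i => |g i|) (fun _ _ => abs_nonneg _)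
      (Finset.mem_univ i)
    simp only [s]; linarith
  have hh : ∀ k, |h k| ≤ s := fun k => by
    have := Finset.single_le_sum (f := fun k => |h k|) (fun _ _ => abs_nonneg _)
      (Finset.mem_univ k)
    simp only [s]; linarith
  replace hdom := hdom g h s (by positivity) hg hh
  set R := C * (1 + s)
  have hK : IsCompact (polySet G B g h ∩ Set.pi Set.univ fun _ => Set.Icc (-R) R) :=
    (isCompact_univ_pi fun _ => isCompact_Icc).inter_left (isClosed_polySet G B g h)
  obtain ⟨x₁, hx₁⟩ := hne
  obtain ⟨y₁, hy₁, -, hy₁b⟩ := hdom x₁ hx₁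
  obtain ⟨x, hx, hmin⟩ := hK.exists_isMinOn ⟨y₁, hy₁, fun j _ => abs_le.1 (hy₁b j)⟩
    (continuous_quad Q c).continuousOn
  refine ⟨x, hx.1, fun y hy => ?_⟩
  obtain ⟨z, hz, hzy, hzb⟩ := hdom y hy
  exact (hmin ⟨hz, fun j _ => abs_le.1 (hzb j)⟩ : quad Q c x ≤ quad Q c z).trans hzy

/-- Changing the right-hand side of the equations by `r` increases the objective by at most
`K₁ r² + K₂ (1 + s) r`, where `s` bounds the right-hand sides. -/
theorem quad_perturbation_bound (hQ : Q.PosSemidef) (hrc : RecessionCondition G B Q c) :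
    ∃ K₁ K₂ : ℝ, 0 ≤ K₁ ∧ 0 ≤ K₂ ∧ ∀ (g : ι → ℝ) (h h' : κ → ℝ) (s r : ℝ), 0 ≤ s → 0 ≤ r →
      (∀ i, |g i| ≤ s) → (∀ k, |h' k| ≤ s) → (∀ k, |h' k - h k| ≤ r) →
      (polySet G B g h).Nonempty → ∀ x ∈ polySet G B g h',
        ∃ y ∈ polySet G B g h, quad Q c y ≤ quad Q c x + K₁ * r ^ 2 + K₂ * (1 + s) * r := by
  obtain ⟨C, hC, hdom⟩ := exists_small_dominating hQ hrc
  obtain ⟨H, hH, hhoff⟩ := hoffman_bound G B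
  set σ : ℝ := ∑ i, ∑ j, |Q i j|
  have hσ : 0 ≤ σ := Finset.sum_nonneg fun i _ => Finset.sum_nonneg fun j _ => abs_nonneg _
  set γ : ℝ := ∑ j, |c j|
  have hγ : 0 ≤ γ := Finset.sum_nonneg fun i _ => abs_nonneg _
  refine ⟨σ * (H * H), σ * (H * C) + γ * H, by positivity, by positivity,
    fun g h h' s r hs hr hg hh hhh hne x hx => ?_⟩
  -- Moving `x` directly would cost an amount growing with the size of `x`, so it is first replaced
  -- by a dominating point of controlled size.
  obtain ⟨z, hz, hzx, hzb⟩ := hdom g h' s hs hg hh x hx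
  obtain ⟨y, hy, hyb⟩ := hhoff g h r z hr (fun i => by linarith [hz.1 i])
    (fun k => by rw [hz.2 k]; exact hhh k) hne
  refine ⟨y, hy, ?_⟩
  have h1 := quad_add hQ c z (y - z)
  have hd : ∀ j, |(y - z) j| ≤ H * r := hyb
  have h2 := (abs_le.1 (abs_dotProduct_mulVec_le Q (by positivity) hd hzb)).2
  have h3 := (abs_le.1 (abs_dotProduct_mulVec_le Q (by positivity) hd hd)).2
  have h4 := (abs_le.1 (abs_dotProduct_le c _ hd)).1
  have h5 := quadForm_nonneg hQ (y - z)
  rw [add_sub_cancel, sub_dotProduct, dotProduct_comm (Q *ᵥ z)] at h1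
  change _ ≤ σ * _ at h2
  change _ ≤ σ * _ at h3
  change -(γ * _) ≤ _ at h4
  have h6 : γ * (H * r) ≤ γ * (H * r) * (1 + s) :=
    le_mul_of_one_le_right (by positivity) (by linarith)
  have h7 : σ * (H * H) * r ^ 2 + (σ * (H * C) + γ * H) * (1 + s) * r =
    σ * (H * r * (H * r)) + σ * (H * r * (C * (1 + s))) + γ * (H * r) * (1 + s) := by ring
  linarith

/-- A minimizer of a convex quadratic program has Lagrange multipliers for the equations. -/
theorem exists_equality_multiplier (hQ : Q.PosSemidef) {g : ι → ℝ} {h : κ → ℝ} {x : J → ℝ}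
    (hx : x ∈ polySet G B g h) (hmin : ∀ y ∈ polySet G B g h, quad Q c x ≤ quad Q c y) :
    ∃ ν : κ → ℝ, ∀ y, (∀ i, (G *ᵥ y) i ≤ g i) →
      quad Q c x ≤ quad Q c y + ν ⬝ᵥ (h - B *ᵥ y) := by
  classical
  -- Only the active constraints matter: a direction admissible for them is feasible for short
  -- steps, so the gradient is nonnegative along it and Farkas supplies multipliers.
  let Ga : Matrix {i // (G *ᵥ x) i = g i} J ℝ := G.submatrix Subtype.val id
  have hGa : ∀ d i, (Ga *ᵥ d) i = (G *ᵥ d) i.1 := fun d i => rfl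
  obtain ⟨μ, ν, hμ, heq, -⟩ := affine_farkas Ga B (g := 0) (h := 0) ⟨0, by simp [polySet]⟩
    (Q *ᵥ x - c) 0 (fun d hd => by
      have hfeas : ∀ᶠ ε in nhdsWithin (0 : ℝ) (Set.Ioi 0), x + ε • d ∈ polySet G B g h := by
        have h1 : ∀ᶠ ε in nhdsWithin (0 : ℝ) (Set.Ioi 0), ∀ i, (G *ᵥ (x + ε • d)) i ≤ g i := by
          refine Filter.eventually_all.2 fun i => ?_
          by_cases hi : (G *ᵥ x) i = g i
          · filter_upwards [self_mem_nhdsWithin] with ε hε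
            have h2 := hd.1 ⟨i, hi⟩
            rw [hGa] at h2
            simp only [Matrix.mulVec_add, Matrix.mulVec_smul, Pi.add_apply, Pi.smul_apply,
              smul_eq_mul, hi]
            have h3 : ε * (G *ᵥ d) i ≤ 0 := mul_nonpos_of_nonneg_of_nonpos (le_of_lt hε) h2
            linarith
          · have hc : Continuous fun ε : ℝ => (G *ᵥ (x + ε • d)) i := by
              simp only [Matrix.mulVec_add, Matrix.mulVec_smul, Pi.add_apply, Pi.smul_apply]
              fun_prop
            filter_upwards [((hc.continuousAt (x := 0)).eventually (gt_mem_nhds (by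
              simpa using lt_of_le_of_ne (hx.1 i) hi))).filter_mono nhdsWithin_le_nhds]
              with ε hε using hε.le
        filter_upwards [h1] with ε hε
        refine ⟨hε, fun k => ?_⟩
        have h2 : (B *ᵥ d) k = 0 := hd.2 k
        simp [Matrix.mulVec_add, Matrix.mulVec_smul, h2, hx.2 k]
      by_contra! hneg
      have hc : Continuous fun ε : ℝ =>
        (Q *ᵥ x - c) ⬝ᵥ d + (1 / 2) * (ε * (d ⬝ᵥ (Q *ᵥ d))) := by fun_prop
      have hat : (Q *ᵥ x - c) ⬝ᵥ d + (1 / 2) * ((0 : ℝ) * (d ⬝ᵥ (Q *ᵥ d))) < 0 := by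
        rw [zero_mul, mul_zero, add_zero]; exact hneg
      have hev := ((hc.continuousAt (x := 0)).eventually (gt_mem_nhds hat)).filter_mono
        (nhdsWithin_le_nhds (s := Set.Ioi 0))
      obtain ⟨ε, ⟨hε, hlt⟩, hε0⟩ := ((hfeas.and hev).and self_mem_nhdsWithin).exists
      have h1 := hmin _ hε
      rw [quad_add hQ] at h1
      simp only [smul_dotProduct, Matrix.mulVec_smul, dotProduct_smul, smul_eq_mul] at h1
      have h2 : 0 < ε := hε0
      nlinarith)
  refine ⟨-ν, fun y hy => ?_⟩
  have h1 := quad_add hQ c x (y - x)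
  have h2 := quadForm_nonneg hQ (y - x)
  rw [add_sub_cancel] at h1
  have h3 : (Q *ᵥ x - c) ⬝ᵥ (y - x) = -(μ ⬝ᵥ (Ga *ᵥ (y - x))) - ν ⬝ᵥ (B *ᵥ (y - x)) := by
    rw [eq_neg_of_add_eq_zero_right heq, neg_dotProduct, add_dotProduct,
      ← Matrix.dotProduct_mulVec, ← Matrix.dotProduct_mulVec]
    ring
  have h4 : μ ⬝ᵥ (Ga *ᵥ (y - x)) ≤ 0 := Finset.sum_nonpos fun i _ =>
    mul_nonpos_of_nonneg_of_nonpos (hμ i) (by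
      have h5 := hy i.1
      have h6 := i.2
      rw [hGa, Matrix.mulVec_sub, Pi.sub_apply]
      linarith)
  have h5 : B *ᵥ x = h := funext hx.2
  rw [Matrix.mulVec_sub B, h5, ← neg_sub h, dotProduct_neg] at h3
  rw [neg_dotProduct]
  linarith

end ConvexQuadratic

/-! ### Infima in the extended reals and comparison of norms. -/

section Values

theorem iInf_coe_eq_of_minimizer {α : Type*} {S : Set α} {F : α → ℝ} {x : α} (hx : x ∈ S)
    (hmin : ∀ y ∈ S, F x ≤ F y) : ⨅ y ∈ S, ((F y : ℝ) : EReal) = (F x : EReal) :=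
  le_antisymm (iInf₂_le x hx) (le_iInf₂ fun y hy => EReal.coe_le_coe_iff.2 (hmin y hy))

/-- On a finite-dimensional normed space a definite seminorm dominates a multiple of the norm. -/
theorem Seminorm.exists_pos_mul_norm_le {V : Type*} [NormedAddCommGroup V] [NormedSpace ℝ V]
    [FiniteDimensional ℝ V] (ν : Seminorm ℝ V) (hν : ∀ u, ν u = 0 → u = 0) :
    ∃ κ : ℝ, 0 < κ ∧ ∀ u, κ * ‖u‖ ≤ ν u := by
  have hcont : Continuous ν := continuousOn_univ.1 (ν.convexOn.continuousOn isOpen_univ)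
  rcases (Metric.sphere (0 : V) 1).eq_empty_or_nonempty with he | hne
  · refine ⟨1, one_pos, fun u => ?_⟩
    by_cases hu : u = 0
    · simp [hu]
    · have : ‖u‖⁻¹ • u ∈ Metric.sphere (0 : V) 1 := by
        simp [norm_smul, norm_ne_zero_iff.2 hu]
      simp [he] at this
  · obtain ⟨v, hv, hmin⟩ := (isCompact_sphere (0 : V) 1).exists_isMinOn hne hcont.continuousOn
    have hv0 : v ≠ 0 := by rintro rfl; simp at hv
    refine ⟨ν v, lt_of_le_of_ne (apply_nonneg ν v) fun h => hv0 (hν v h.symm), fun u => ?_⟩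
    by_cases hu : u = 0
    · simp [hu]
    · have h1 : ν v ≤ ν (‖u‖⁻¹ • u) := hmin (by simp [norm_smul, norm_ne_zero_iff.2 hu])
      rw [map_smul_eq_mul, norm_inv, norm_norm, inv_mul_eq_div] at h1
      exact (le_div_iff₀ (norm_pos_iff.2 hu)).1 h1

end Values

/-! ### The mixed-integer program: decomposition into fibers and the penalty estimate. -/

namespace MIQP

variable {n₁ n₂ m p : ℕ} (P : MIQP n₁ n₂ m p)

/-- The matrix `x ↦ x_I`. -/
def intRows (n₁ n₂ : ℕ) : Matrix (Fin n₁) (Fin n₁ ⊕ Fin n₂) ℝ :=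
  Matrix.of fun i => Pi.single (Sum.inl i) 1

theorem intRows_mulVec (x : MixedVec n₁ n₂) (i : Fin n₁) :
    (intRows n₁ n₂ *ᵥ x) i = x (Sum.inl i) := by
  change (Pi.single (Sum.inl i) 1 : MixedVec n₁ n₂) ⬝ᵥ x = _
  rw [single_dotProduct, one_mul]

/-- The matrix `x ↦ (x_I, A x)`. -/
def fiberRows : Matrix (Fin n₁ ⊕ Fin m) (Fin n₁ ⊕ Fin n₂) ℝ :=
  Matrix.fromRows (intRows n₁ n₂) (P.A.map (fun q : ℚ => (q : ℝ)))

/-- The points of the perturbed feasible set with prescribed integer part. -/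
def fiber (z : Fin n₁ → ℤ) (u : RHSVec m) : Set (MixedVec n₁ n₂) :=
  polySet (P.E.map (fun q : ℚ => (q : ℝ))) P.fiberRows (fun k => (P.f k : ℝ))
    (Sum.elim (fun i => (z i : ℝ)) (ratVec P.b + u))

/-- The integer vectors in the box `‖z‖_∞ ≤ M`. -/
def intBox : Set (Fin n₁ → ℤ) := {z | ∀ i, |(z i : ℝ)| ≤ P.M}

theorem finite_intBox : P.intBox.Finite := by
  refine (Set.Finite.pi' fun _ : Fin n₁ => Set.finite_Icc (-⌈P.M⌉) ⌈P.M⌉).subset fun z hz i => ?_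
  have h1 := abs_le.1 (hz i)
  have h2 := Int.le_ceil P.M
  constructor
  · have : -(⌈P.M⌉ : ℝ) ≤ z i := by linarith
    exact_mod_cast this
  · have : (z i : ℝ) ≤ ⌈P.M⌉ := by linarith
    exact_mod_cast this

theorem mem_fiber {z : Fin n₁ → ℤ} {u : RHSVec m} {x : MixedVec n₁ n₂} :
    x ∈ P.fiber z u ↔ (∀ k, (P.E.map (fun q : ℚ => (q : ℝ)) *ᵥ x) k ≤ (P.f k : ℝ)) ∧
      (∀ i, x (Sum.inl i) = z i) ∧ x ∈ P.hyperplane u := by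
  rw [fiber, polySet, fiberRows]
  simp only [Matrix.fromRows_mulVec, Set.mem_ofPred_eq, Sum.forall, Sum.elim_inl, Sum.elim_inr,
    intRows_mulVec]
  refine and_congr_right fun _ => and_congr_right fun _ => ?_
  rw [hyperplane, Set.mem_ofPred_eq, lhs]
  exact ⟨fun h => by ext k; exact h k, fun h k => congrFun (congrArg WithLp.ofLp h) k⟩

/-- The bridge from mixed-integer to polyhedral: with `finite_intBox`, the feasible set is a finite
union of polyhedra, each given by fixing `x_I` through equations. -/
theorem mem_feasible_iff {u : RHSVec m} {x : MixedVec n₁ n₂} :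
    x ∈ P.mixedSet ∩ P.hyperplane u ↔ ∃ z ∈ P.intBox, x ∈ P.fiber z u := by
  simp only [mem_fiber, mixedSet, relaxSet, Set.mem_inter_iff, Set.mem_ofPred_eq, intBox]
  constructor
  · rintro ⟨⟨⟨hE, hM⟩, hz⟩, hu⟩
    choose z hz using hz
    exact ⟨z, fun i => hz i ▸ hM i, hE, hz, hu⟩
  · rintro ⟨z, hzM, hE, hz, hu⟩
    exact ⟨⟨⟨hE, fun i => by rw [hz i]; exact hzM i⟩, fun i => ⟨z i, hz i⟩⟩, hu⟩

theorem mem_hyperplane_zero {x : MixedVec n₁ n₂} :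
    x ∈ P.hyperplane 0 ↔ P.lhs x = ratVec P.b := by
  rw [hyperplane, Set.mem_ofPred_eq, add_zero]

theorem mem_hyperplane_neg_residual (x : MixedVec n₁ n₂) :
    x ∈ P.hyperplane (-P.residual x) := by
  rw [hyperplane, Set.mem_ofPred_eq, residual]; abel

theorem optValue_eq_value : P.optValue = P.value 0 := by
  have : {x | x ∈ P.mixedSet ∧ P.lhs x = ratVec P.b} = P.mixedSet ∩ P.hyperplane 0 := by
    ext x; rw [Set.mem_inter_iff, mem_hyperplane_zero]; rfl
  rw [optValue, value, this]

/-- The recession condition for the systems with fixed integer part. -/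
def FiberRecession : Prop :=
  RecessionCondition (P.E.map (fun q : ℚ => (q : ℝ))) P.fiberRows
    (P.Q.map (fun q : ℚ => (q : ℝ))) (fun j => (P.c j : ℝ))

theorem obj_eq_quad (x : MixedVec n₁ n₂) :
    P.obj x = quad (P.Q.map (fun q : ℚ => (q : ℝ))) (fun j => (P.c j : ℝ)) x := rfl

theorem relaxValue_le {x : MixedVec n₁ n₂} (hx : x ∈ P.relaxSet) (hb : P.lhs x = ratVec P.b) :
    P.relaxValue ≤ (P.obj x : EReal) :=
  iInf₂_le (f := fun x (_ : x ∈ {x | x ∈ P.relaxSet ∧ P.lhs x = ratVec P.b}) =>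
    ((P.obj x : ℝ) : EReal)) x ⟨hx, hb⟩

/-- If the relaxation has a finite value, then the recession condition holds. -/
theorem fiberRecession_of_finite (hQ : (P.Q.map (fun q : ℚ => (q : ℝ))).PosSemidef)
    {x : MixedVec n₁ n₂} (hx : x ∈ P.relaxSet) (hb : P.lhs x = ratVec P.b) {zR : ℝ}
    (hzR : P.relaxValue = (zR : EReal)) :
    P.FiberRecession := by
  intro d hE hd hQd
  rw [fiberRows] at hd
  simp only [Matrix.fromRows_mulVec, Sum.forall, Sum.elim_inl, Sum.elim_inr,
    intRows_mulVec] at hd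
  obtain ⟨hdI, hdA⟩ := hd
  replace hdA : P.A.map (fun q : ℚ => (q : ℝ)) *ᵥ d = 0 := funext hdA
  have key : ∀ t : ℝ, 0 ≤ t → zR ≤ P.obj x - t * ((fun j => (P.c j : ℝ)) ⬝ᵥ d) := by
    intro t ht
    have h1 : P.obj (x + t • d) = P.obj x - t * ((fun j => (P.c j : ℝ)) ⬝ᵥ d) := by
      rw [obj_eq_quad, quad_add hQ, Matrix.mulVec_smul, hQd, smul_zero, dotProduct_zero,
        dotProduct_smul, sub_dotProduct, dotProduct_comm (_ *ᵥ x), dotProduct_mulVec_symm hQ d x,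
        hQd, dotProduct_zero, ← obj_eq_quad, smul_eq_mul]
      ring
    rw [← EReal.coe_le_coe_iff, ← hzR, ← h1]
    refine P.relaxValue_le ⟨fun k => ?_, fun i => ?_⟩ ?_
    · have h2 := hx.1 k
      have h3 : t * (P.E.map (fun q : ℚ => (q : ℝ)) *ᵥ d) k ≤ 0 :=
        mul_nonpos_of_nonneg_of_nonpos ht (hE k)
      simp only [Matrix.mulVec_add, Matrix.mulVec_smul, Pi.add_apply, Pi.smul_apply, smul_eq_mul]
      linarith
    · simpa [hdI] using hx.2 i
    · rw [← hb, lhs, lhs, Matrix.mulVec_add, Matrix.mulVec_smul, hdA, smul_zero, add_zero]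
  by_contra! hpos
  -- This step length lowers the objective by `|P.obj x - zR| + 1`, which takes it below `zR`.
  have h1 := key ((|P.obj x - zR| + 1) / ((fun j => (P.c j : ℝ)) ⬝ᵥ d)) (by positivity)
  rw [div_mul_cancel₀ _ hpos.ne'] at h1
  linarith [le_abs_self (P.obj x - zR)]

variable {P}

/-- The perturbed programs attain their minima. -/
theorem exists_optimal (hQ : (P.Q.map (fun q : ℚ => (q : ℝ))).PosSemidef)
    (hrc : P.FiberRecession) {u : RHSVec m} (hu : u ∈ P.perturbations) :
    ∃ x ∈ P.mixedSet ∩ P.hyperplane u, ∀ y ∈ P.mixedSet ∩ P.hyperplane u, P.obj x ≤ P.obj y := by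
  classical
  have hfin : {z ∈ P.intBox | (P.fiber z u).Nonempty}.Finite :=
    P.finite_intBox.subset fun z hz => hz.1
  have hmin : ∀ z : Fin n₁ → ℤ, ∃ x, (P.fiber z u).Nonempty →
      x ∈ P.fiber z u ∧ ∀ y ∈ P.fiber z u, P.obj x ≤ P.obj y := by
    intro z
    by_cases hz : (P.fiber z u).Nonempty
    · obtain ⟨x, hx, hxm⟩ := exists_minimizer hQ hrc hz
      exact ⟨x, fun _ => ⟨hx, hxm⟩⟩
    · exact ⟨0, fun h => absurd h hz⟩
  choose X hX using hmin
  obtain ⟨y, hy⟩ := hu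
  obtain ⟨z₁, hz₁, hy₁⟩ := P.mem_feasible_iff.1 hy
  obtain ⟨z, hz, hzm⟩ := Set.exists_min_image _ (fun z => P.obj (X z)) hfin ⟨z₁, hz₁, y, hy₁⟩
  refine ⟨X z, P.mem_feasible_iff.2 ⟨z, hz.1, (hX z hz.2).1⟩, fun y hy => ?_⟩
  obtain ⟨z', hz', hy'⟩ := P.mem_feasible_iff.1 hy
  exact (hzm z' ⟨hz', y, hy'⟩).trans ((hX z' ⟨y, hy'⟩).2 y hy')

variable (P) in
/-- For small perturbations no fiber becomes feasible that was infeasible. -/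
theorem exists_fiber_radius : ∃ δ : ℝ, 0 < δ ∧ δ ≤ 1 ∧ ∀ u : RHSVec m, ‖u‖ ≤ δ →
    ∀ z ∈ P.intBox, (P.fiber z u).Nonempty → (P.fiber z 0).Nonempty := by
  have hev : ∀ᶠ u in nhds (0 : RHSVec m), ∀ z ∈ P.intBox,
      (P.fiber z u).Nonempty → (P.fiber z 0).Nonempty := by
    refine (Filter.eventually_all_finite P.finite_intBox).2 fun z _ => ?_
    by_cases hz : (P.fiber z 0).Nonempty
    · exact Filter.Eventually.of_forall fun _ _ => hz
    · have hcont : Continuous fun u : RHSVec m => ((fun k => (P.f k : ℝ) : Fin p → ℝ),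
          (Sum.elim (fun i => (z i : ℝ)) (ratVec P.b + u) : Fin n₁ ⊕ Fin m → ℝ)) := by
        refine continuous_const.prodMk (continuous_pi fun k => ?_)
        rcases k with i | k
        · exact continuous_const
        · simp only [Sum.elim_inr]
          fun_prop
      have hcl := (isClosed_solvable (P.E.map (fun q : ℚ => (q : ℝ))) P.fiberRows).preimage hcont
      filter_upwards [hcl.isOpen_compl.mem_nhds hz] with u hu h
      exact absurd h hu
  obtain ⟨ε, hε, h⟩ := Metric.nhds_basis_closedBall.eventually_iff.1 hev
  exact ⟨min ε 1, lt_min hε one_pos, min_le_right _ _, fun u hu =>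
    h (mem_closedBall_zero_iff.2 (hu.trans (min_le_left _ _)))⟩

/-- Feasible points of slightly perturbed programs are close in value to feasible ones of the
unperturbed program. -/
theorem exists_feasible_near {K₁ K₂ : ℝ} (hK : ∀ (g : Fin p → ℝ) (h h' : Fin n₁ ⊕ Fin m → ℝ)
      (s r : ℝ), 0 ≤ s → 0 ≤ r → (∀ i, |g i| ≤ s) → (∀ k, |h' k| ≤ s) →
      (∀ k, |h' k - h k| ≤ r) →
      (polySet (P.E.map (fun q : ℚ => (q : ℝ))) P.fiberRows g h).Nonempty →
      ∀ x ∈ polySet (P.E.map (fun q : ℚ => (q : ℝ))) P.fiberRows g h',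
        ∃ y ∈ polySet (P.E.map (fun q : ℚ => (q : ℝ))) P.fiberRows g h,
          P.obj y ≤ P.obj x + K₁ * r ^ 2 + K₂ * (1 + s) * r) :
    ∃ δ : ℝ, 0 < δ ∧ ∀ u : RHSVec m, ‖u‖ ≤ δ → ∀ x ∈ P.mixedSet ∩ P.hyperplane u,
      ∃ y ∈ P.mixedSet ∩ P.hyperplane 0, P.obj y ≤ P.obj x + (K₁ * ‖u‖ ^ 2 +
        (K₂ * (2 + |P.M|) + K₂ * (‖ratVec P.b‖ + ‖ratVec P.f‖)) * ‖u‖) := by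
  obtain ⟨δ, hδ, hδ1, hfib⟩ := P.exists_fiber_radius
  refine ⟨δ, hδ, fun u hu x hx => ?_⟩
  obtain ⟨z, hz, hxz⟩ := P.mem_feasible_iff.1 hx
  have hb0 := norm_nonneg (ratVec P.b)
  have hf0 := norm_nonneg (ratVec P.f)
  have hM0 := abs_nonneg P.M
  -- The final `+ 1` in the bound `s` absorbs `‖u‖ ≤ δ ≤ 1`. Then `1 + s` equals `2 + |P.M|` plus
  -- the two norms, which is the split of the linear coefficient.
  obtain ⟨y, hy, hyx⟩ := hK (fun k => (P.f k : ℝ))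
    (Sum.elim (fun i => (z i : ℝ)) (ratVec P.b + 0 : RHSVec m))
    (Sum.elim (fun i => (z i : ℝ)) (ratVec P.b + u : RHSVec m))
    (|P.M| + ‖ratVec P.b‖ + ‖ratVec P.f‖ + 1) ‖u‖ (by positivity) (norm_nonneg _)
    (fun k => by
      have : |(P.f k : ℝ)| ≤ ‖ratVec P.f‖ := PiLp.norm_apply_le (ratVec P.f) k
      linarith)
    (by
      rintro (i | k)
      · have h1 := hz i
        have h2 := le_abs_self P.M
        rw [Sum.elim_inl]; linarith
      · have h1 : |(ratVec P.b + u) k| ≤ ‖ratVec P.b + u‖ :=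
          PiLp.norm_apply_le (ratVec P.b + u) k
        have h2 := norm_add_le (ratVec P.b) u
        rw [Sum.elim_inr]; linarith)
    (by
      rintro (i | k)
      · simp
      · have h1 : |u k| ≤ ‖u‖ := PiLp.norm_apply_le u k
        simpa using h1)
    (hfib u hu z hz ⟨x, hxz⟩) x hxz
  refine ⟨y, P.mem_feasible_iff.2 ⟨z, hz, hy⟩, hyx.trans (le_of_eq ?_)⟩
  ring

/-- The continuous relaxation has a Lagrange multiplier. -/
theorem exists_relaxMultiplier (hQ : (P.Q.map (fun q : ℚ => (q : ℝ))).PosSemidef)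
    (hrc : P.FiberRecession) {x₁ : MixedVec n₁ n₂} (hx₁ : x₁ ∈ P.relaxSet)
    (hb₁ : P.lhs x₁ = ratVec P.b) : ∃ lam : RHSVec m, P.IsRelaxMultiplier lam := by
  let G := Matrix.fromRows (P.E.map (fun q : ℚ => (q : ℝ)))
    (Matrix.fromRows (intRows n₁ n₂) (-intRows n₁ n₂))
  let g : Fin p ⊕ (Fin n₁ ⊕ Fin n₁) → ℝ :=
    Sum.elim (fun k => (P.f k : ℝ)) (Sum.elim (fun _ => P.M) (fun _ => P.M))
  have hG : ∀ x, x ∈ P.relaxSet ↔ ∀ i, (G *ᵥ x) i ≤ g i := by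
    intro x
    simp only [G, g, relaxSet, Matrix.fromRows_mulVec, Sum.forall, Sum.elim_inl, Sum.elim_inr,
      Matrix.neg_mulVec, Pi.neg_apply, intRows_mulVec, Set.mem_ofPred_eq, abs_le', forall_and]
  have hA : ∀ x, P.lhs x = ratVec P.b ↔
      ∀ k, (P.A.map (fun q : ℚ => (q : ℝ)) *ᵥ x) k = (P.b k : ℝ) := fun x =>
    ⟨fun h k => congrFun (congrArg WithLp.ofLp h) k, fun h => by ext k; exact h k⟩
  -- The box bounds force `d_I = 0` for recession directions of `X_R`, so the condition for the
  -- fibers is also the one for the relaxation.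
  have hrcR : RecessionCondition G (P.A.map (fun q : ℚ => (q : ℝ)))
      (P.Q.map (fun q : ℚ => (q : ℝ))) (fun j => (P.c j : ℝ)) := by
    intro d hd hAd hQd
    simp only [G, Matrix.fromRows_mulVec, Sum.forall, Sum.elim_inl, Sum.elim_inr,
      Matrix.neg_mulVec, Pi.neg_apply, intRows_mulVec] at hd
    refine hrc d hd.1 ?_ hQd
    rw [fiberRows]
    simp only [Matrix.fromRows_mulVec, Sum.forall, Sum.elim_inl, Sum.elim_inr, intRows_mulVec]
    exact ⟨fun i => le_antisymm (hd.2.1 i) (by linarith [hd.2.2 i]), hAd⟩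
  obtain ⟨x, hx, hmin⟩ := exists_minimizer hQ hrcR (g := g) (h := fun k => (P.b k : ℝ))
    ⟨x₁, (hG _).1 hx₁, (hA _).1 hb₁⟩
  obtain ⟨ν, hν⟩ := exists_equality_multiplier hQ hx hmin
  refine ⟨WithLp.toLp 2 ν, fun y hy => (P.relaxValue_le ((hG x).2 hx.1) ((hA x).2 hx.2)).trans ?_⟩
  rw [EReal.coe_le_coe_iff]
  refine (hν y ((hG y).1 hy)).trans (le_of_eq ?_)
  rw [← obj_eq_quad]
  congr 1
  simp only [PiLp.inner_apply, dotProduct]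
  refine Finset.sum_congr rfl fun k _ => ?_
  exact mul_comm _ _

/-- The penalized objective on `X` is at least the optimal value, for a large penalty. -/
theorem le_obj_add_penalty {x₀ : MixedVec n₁ n₂} {zR δ κ₁ κ₂ ρ : ℝ} {lam : RHSVec m}
    (hδ : 0 < δ) (hκ₁ : 0 ≤ κ₁)
    (hnear : ∀ u : RHSVec m, ‖u‖ ≤ δ → ∀ x ∈ P.mixedSet ∩ P.hyperplane u,
      P.obj x₀ ≤ P.obj x + (κ₁ * ‖u‖ ^ 2 + κ₂ * ‖u‖))
    (hzR : P.relaxValue = (zR : EReal)) (hle : zR ≤ P.obj x₀) (hlam : P.IsRelaxMultiplier lam)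
    (hρ : max (κ₁ * δ + κ₂) (‖lam‖ + (P.obj x₀ - zR) / δ) < ρ) {x : MixedVec n₁ n₂}
    (hx : x ∈ P.mixedSet) : P.obj x₀ ≤ P.obj x + ρ * ‖P.residual x‖ := by
  obtain ⟨hρ₁, hρ₂⟩ := max_lt_iff.1 hρ
  set r := P.residual x
  have hr : 0 ≤ ‖r‖ := norm_nonneg _
  -- Near the hyperplane the quadratic term is at most `κ₁ δ ‖r‖`. Far from it the multiplier gives
  -- `P.obj x ≥ zR - ‖lam‖ ‖r‖`, and `‖r‖ > δ` turns the gap to `zR` into a multiple of `‖r‖`.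
  rcases le_or_gt ‖r‖ δ with hrδ | hrδ
  · have h1 := hnear (-r) (by rwa [norm_neg]) x ⟨hx, P.mem_hyperplane_neg_residual x⟩
    rw [norm_neg] at h1
    have h2 : κ₁ * ‖r‖ ^ 2 ≤ κ₁ * δ * ‖r‖ := by
      rw [sq, ← mul_assoc]
      exact mul_le_mul_of_nonneg_right (mul_le_mul_of_nonneg_left hrδ hκ₁) hr
    have h3 := mul_le_mul_of_nonneg_right hρ₁.le hr
    linarith
  · have h1 := hlam x hx.1
    rw [hzR, EReal.coe_le_coe_iff] at h1
    have h2 := real_inner_le_norm lam r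
    have h3 : 0 ≤ (P.obj x₀ - zR) / δ := div_nonneg (by linarith) hδ.le
    have h4 : (P.obj x₀ - zR) / δ * δ ≤ (ρ - ‖lam‖) * ‖r‖ :=
      mul_le_mul (by linarith) hrδ.le hδ.le (by linarith)
    rw [div_mul_cancel₀ _ hδ.ne'] at h4
    linarith

theorem residual_eq_zero {x : MixedVec n₁ n₂} (hx : x ∈ P.hyperplane 0) : P.residual x = 0 := by
  rw [residual, P.mem_hyperplane_zero.1 hx, sub_self]

theorem sharpRelaxation_eq {x₀ : MixedVec n₁ n₂} (hx₀ : x₀ ∈ P.mixedSet ∩ P.hyperplane 0) {ρ : ℝ}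
    (h : ∀ x ∈ P.mixedSet, P.obj x₀ ≤ P.obj x + ρ * ‖P.residual x‖) :
    P.sharpRelaxation ρ = (P.obj x₀ : EReal) := by
  have h0 : P.obj x₀ + ρ * ‖P.residual x₀‖ = P.obj x₀ := by
    rw [residual_eq_zero hx₀.2, norm_zero, mul_zero, add_zero]
  rw [sharpRelaxation, iInf_coe_eq_of_minimizer (F := fun x => P.obj x + ρ * ‖P.residual x‖)
    hx₀.1 (fun y hy => by simpa only [h0] using h y hy), h0]

/-- At the feasible point `x₀` both the linear and the penalty term vanish, which caps every dual
value; `λ = 0` already reaches the cap. -/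
theorem augDual_eq {x₀ : MixedVec n₁ n₂} (hx₀ : x₀ ∈ P.mixedSet ∩ P.hyperplane 0) {ρ : ℝ}
    {ψ : RHSVec m → ℝ} (hψ : ψ 0 = 0)
    (h : ∀ x ∈ P.mixedSet, P.obj x₀ ≤ P.obj x + ρ * ψ (P.residual x)) :
    P.augDual ψ ρ = (P.obj x₀ : EReal) := by
  refine le_antisymm (iSup_le fun lam => (iInf₂_le x₀ hx₀.1).trans (le_of_eq ?_))
    (le_iSup_of_le 0 (le_iInf₂ fun x hx => ?_))
  · rw [residual_eq_zero hx₀.2, inner_zero_right, hψ, mul_zero, add_zero, add_zero]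
  · rw [inner_zero_left, add_zero]
    exact EReal.coe_le_coe_iff.2 (h x hx)

end MIQP

/-! ### Assembly of the main theorem. -/

theorem theorem2 {n₁ n₂ m p : ℕ}
    (A : Matrix (Fin m) (Fin n₁ ⊕ Fin n₂) ℚ) (E : Matrix (Fin p) (Fin n₁ ⊕ Fin n₂) ℚ)
    (Q : Matrix (Fin n₁ ⊕ Fin n₂) (Fin n₁ ⊕ Fin n₂) ℚ) (c : Fin n₁ ⊕ Fin n₂ → ℚ) (M : ℝ)
    (hQ : (Q.map (fun q : ℚ => (q : ℝ))).PosSemidef) :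
    ∃ K₁ K₂ K₃ : ℝ, 0 ≤ K₁ ∧ 0 ≤ K₂ ∧ 0 ≤ K₃ ∧
      ∀ (b : Fin m → ℚ) (f : Fin p → ℚ) (P : MIQP n₁ n₂ m p),
        P = { A := A, E := E, Q := Q, c := c, M := M, b := b, f := f } →
        -- the program is feasible and its continuous relaxation has a finite optimal value
        (∃ x ∈ P.mixedSet, P.lhs x = ratVec b) →
        ∀ zR : ℝ, P.relaxValue = (zR : EReal) →
          -- all the minima `φ(u)`, `u ∈ U`, are attained; `zIP = φ(0)`
          (∀ u ∈ P.perturbations,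
            ∃ x ∈ P.mixedSet ∩ P.hyperplane u, ((P.obj x : ℝ) : EReal) = P.value u) ∧
          ∃ zIP : ℝ, P.optValue = (zIP : EReal) ∧
          -- exact penalty representation, for the Euclidean norm and for every other norm
          P.HasExactPenalty (fun u => ‖u‖) ∧
          (∀ ν : Seminorm ℝ (RHSVec m), (∀ u, ν u = 0 → u = 0) →
            P.HasExactPenalty (fun u => ν u)) ∧
          -- the penalty parameter
          (∃ lam : RHSVec m, P.IsRelaxMultiplier lam) ∧
          ∃ δ : ℝ, 0 < δ ∧
            (∀ u ∈ P.perturbations, ‖u‖ ≤ δ → P.value u ≤ P.value 0 →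
              |(P.value u).toReal - (P.value 0).toReal| ≤
                K₁ * ‖u‖ ^ 2 + (K₂ + K₃ * (‖ratVec b‖ + ‖ratVec f‖)) * ‖u‖) ∧
            ∀ lam : RHSVec m, P.IsRelaxMultiplier lam →
              ∀ ρ : ℝ,
                max (K₁ * δ + (K₂ + K₃ * (‖ratVec b‖ + ‖ratVec f‖)))
                  (‖lam‖ + (zIP - zR) / δ) < ρ →
                P.sharpRelaxation ρ = (zIP : EReal) ∧
                P.augDual (fun u => ‖u‖) ρ = (zIP : EReal) := by
  -- The condition involves only `A`, `E`, `Q`, `c`, so the constants can be fixed before `b` and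
  -- `f`. If it fails, no feasible instance has finite `z_R` and the claim is vacuous.
  by_cases hrc : RecessionCondition (E.map (fun q : ℚ => (q : ℝ)))
    (Matrix.fromRows (MIQP.intRows n₁ n₂) (A.map (fun q : ℚ => (q : ℝ))))
    (Q.map (fun q : ℚ => (q : ℝ))) (fun j => (c j : ℝ))
  swap
  · refine ⟨0, 0, 0, le_rfl, le_rfl, le_rfl, fun b f P hP ⟨x, hx, hxb⟩ zR hzR => ?_⟩
    subst hP
    exact absurd (MIQP.fiberRecession_of_finite _ hQ hx.1 hxb hzR) hrc
  obtain ⟨K₁, K₂, hK₁, hK₂, hK⟩ := quad_perturbation_bound hQ hrc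
  refine ⟨K₁, K₂ * (2 + |M|), K₂, hK₁, by positivity, hK₂,
    fun b f P hP ⟨x₁, hx₁, hb₁⟩ zR hzR => ?_⟩
  have hPb : b = P.b := by rw [hP]
  have hPf : f = P.f := by rw [hP]
  have hPM : M = P.M := by rw [hP]
  have hQP : (P.Q.map (fun q : ℚ => (q : ℝ))).PosSemidef := by rw [hP]; exact hQ
  have hrcP : P.FiberRecession := by rw [hP]; exact hrc
  obtain ⟨δ, hδ, hnear⟩ := MIQP.exists_feasible_near (P := P) (K₁ := K₁) (K₂ := K₂)
    (by subst hP; exact hK)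
  clear hP hK
  subst hPb hPf hPM
  have h0U : (0 : RHSVec m) ∈ P.perturbations := ⟨x₁, hx₁, P.mem_hyperplane_zero.2 hb₁⟩
  have hval : ∀ u ∈ P.perturbations,
      ∃ x ∈ P.mixedSet ∩ P.hyperplane u, ((P.obj x : ℝ) : EReal) = P.value u := by
    intro u hu
    obtain ⟨x, hx, hmin⟩ := MIQP.exists_optimal hQP hrcP hu
    exact ⟨x, hx, (iInf_coe_eq_of_minimizer hx hmin).symm⟩
  obtain ⟨x₀, hx₀, hmin₀⟩ := MIQP.exists_optimal hQP hrcP h0U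
  have hval₀ : P.value 0 = (P.obj x₀ : EReal) := iInf_coe_eq_of_minimizer hx₀ hmin₀
  have hopt : P.optValue = (P.obj x₀ : EReal) := by rw [P.optValue_eq_value, hval₀]
  set κ₂ : ℝ := K₂ * (2 + |P.M|) + K₂ * (‖ratVec P.b‖ + ‖ratVec P.f‖) with hκ₂
  have hκ₂0 : 0 ≤ κ₂ := by positivity
  have hgap : ∀ u : RHSVec m, ‖u‖ ≤ δ → ∀ x ∈ P.mixedSet ∩ P.hyperplane u,
      P.obj x₀ ≤ P.obj x + (K₁ * ‖u‖ ^ 2 + κ₂ * ‖u‖) := by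
    intro u hu x hx
    obtain ⟨y, hy, hyx⟩ := hnear u hu x hx
    exact (hmin₀ y hy).trans hyx
  have hle : zR ≤ P.obj x₀ := by
    rw [← EReal.coe_le_coe_iff, ← hzR]
    exact P.relaxValue_le hx₀.1.1 (P.mem_hyperplane_zero.1 hx₀.2)
  obtain ⟨lam₀, hlam₀⟩ := MIQP.exists_relaxMultiplier hQP hrcP hx₁.1 hb₁
  have hpen : ∀ lam : RHSVec m, P.IsRelaxMultiplier lam → ∀ ρ : ℝ,
      max (K₁ * δ + κ₂) (‖lam‖ + (P.obj x₀ - zR) / δ) < ρ → ∀ x ∈ P.mixedSet,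
        P.obj x₀ ≤ P.obj x + ρ * ‖P.residual x‖ := fun lam hlam ρ hρ x hx =>
    MIQP.le_obj_add_penalty hδ hK₁ hgap hzR hle hlam hρ hx
  obtain ⟨ρ₀, hρ₀⟩ := exists_gt (max (K₁ * δ + κ₂) (‖lam₀‖ + (P.obj x₀ - zR) / δ))
  have hρ₀pos : 0 < ρ₀ := lt_of_le_of_lt (by positivity) ((le_max_left _ _).trans_lt hρ₀)
  have hpen₀ := hpen lam₀ hlam₀ ρ₀ hρ₀
  refine ⟨hval, P.obj x₀, hopt, ⟨ρ₀, hρ₀pos, ?_⟩, fun ν hν => ?_, ⟨lam₀, hlam₀⟩, δ, hδ,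
    fun u hu huδ hle' => ?_, fun lam hlam ρ hρ => ?_⟩
  · rw [hopt]
    exact MIQP.augDual_eq hx₀ norm_zero hpen₀
  · obtain ⟨κ, hκ, hκν⟩ := ν.exists_pos_mul_norm_le hν
    -- Since `ν` dominates `κ` times the Euclidean norm, the parameter `ρ₀ / κ` penalizes at least
    -- as much as `ρ₀` does there.
    refine ⟨ρ₀ / κ, by positivity, ?_⟩
    rw [hopt]
    refine MIQP.augDual_eq hx₀ (map_zero ν) fun x hx => (hpen₀ x hx).trans ?_
    have h1 := mul_le_mul_of_nonneg_left (hκν (P.residual x)) (div_pos hρ₀pos hκ).le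
    rw [← mul_assoc, div_mul_cancel₀ _ hκ.ne'] at h1
    linarith
  · obtain ⟨x, hx, hxu⟩ := hval u hu
    rw [← hxu, hval₀, EReal.coe_le_coe_iff] at hle'
    -- The assumption `φ(u) ≤ φ(0)` fixes the sign, so only the one-sided bound on `φ(0) - φ(u)` is
    -- needed.
    rw [← hxu, hval₀, EReal.toReal_coe, EReal.toReal_coe, abs_of_nonpos (by linarith)]
    linarith [hgap u huδ x hx]
  · have h := hpen lam hlam ρ hρ
    exact ⟨MIQP.sharpRelaxation_eq hx₀ h, MIQP.augDual_eq hx₀ norm_zero h⟩
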